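/- **Device-independent bound on the fidelity of a qubit memory.** *Experiment.* Let $\mathbf A',\mathbf A,\mathbf B,\mathbf E'$ be finite-dimensional quantum systems, let $\mathbf E$ be a qubit, and let $\mathcal M$ be a quantum channel (a completely positive trace-preserving map) on $\mathbf E$, the qubit memory. Consider a two-point measurement experiment without cross-talk: a state $\varrho$ of $\mathbf A'+\mathbf E$ is prepared and $\mathbf E$ is stored in the memory, so that the state becomes $(\mathrm{id}\otimes\mathcal M)(\varrho)$; for a setting $x$ in a non-empty finite set $\mathcal X$, the system $\mathbf A'$ is measured with a POVM $(E_{a|x})_{a\in\{0,1\}}$ and, after outcome $A=a$, system $\mathbf A$ is prepared in a state $\rho_a$ that depends only on $a$; then $\mathbf A+\mathbf E$ evolves under a unitary $U:\mathcal H_{\mathbf A}\otimes\mathcal H_{\mathbf E}\to\mathcal H_{\mathbf B}\otimes\mathcal H_{\mathbf E'}$, and $\mathbf B$ is measured with a POVM $(F_b)_{b\in\{0,1\}}$. The observed statistics are $$\Pr(A=a,B=b\mid X=x)=\mathrm{Tr}\Big[(F_b\otimes \mathrm{id}_{\mathbf E'})\,U\Big(\rho_a\otimes \mathrm{Tr}_{\mathbf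 A'}\big[(E_{a|x}\otimes \mathrm{id}_{\mathbf E})(\mathrm{id}\otimes\mathcal M)(\varrho)\big]\Big)U^\dagger\Big],$$ and $$\Gamma=\sum_{b_0,b_1\in\{0,1\}}\ \inf_{x\in\mathcal X}\ \sum_{a\in\{0,1\}}\Pr(A=a,B=b_a\mid X=x).$$ *Fidelity.* Let $|\mathrm{id}\rangle=(|00\rangle+|11\rangle)/\sqrt2$. An ideal memory is the identity channel up to a fixed unitary, which can be undone after retrieval; the fidelity of $\mathcal M$ to an ideal memory is accordingly $$F_{\rm Memory}=\sup_{V\in U(2)}\ \langle \mathrm{id}|\,(\mathrm{id}\otimes \mathcal V\circ\mathcal M)(|\mathrm{id}\rangle\langle \mathrm{id}|)\,|\mathrm{id}\rangle,\qquad \mathcal V(R)=VRV^\dagger,$$ that is, the largest fidelity of the Choi state of $\mathcal M$ to the Choi state of a unitary channel. *Claim.* If the statistics violate the classical inequality $\Gamma\ge 1$, i.e. if $\Gamma<1$, then $$F_{\rm Memory}\ \ge\ \frac12\left[1-\frac{\Gamma-2+S_{\rm K}}{\sqrt2-S_{\rm K}}\right],\qquad S_{\rm K}=\frac{8+7\sqrt2}{17}.$$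 The bound is device-independent: it holds for every channel $\mathcal M$ on the qubit, all finite dimensions of the other systems, and every choice of $\varrho$, $E_{a|x}$, $\rho_a$, $U$, $F_b$. -/

import Mathlib

open scoped Matrix Kronecker ComplexOrder

noncomputable section

namespace TPM

/-! ### States, measurements and channels on finite-dimensional systems -/

/-- A density operator on `ℂ^n`. -/
structure IsDensity {n : Type*} [Fintype n] (ρ : Matrix n n ℂ) : Prop where
  posSemidef : ρ.PosSemidef
  trace_one : ρ.trace = 1

/-- A two-outcome positive-operator-valued measure on `ℂ^n`. -/
structure IsPOVM {n : Type*} [Fintype n] [DecidableEq n] (E : Fin 2 → Matrix n n ℂ) : Prop where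
  posSemidef : ∀ a, (E a).PosSemidef
  sum_eq_one : ∑ a, E a = 1

/-- `ampliation κ Φ` is the map `id ⊗ Φ`, where `id` acts on the first factor `ℂ^κ`:
`Φ` is applied to every block of a block matrix. -/
def ampliation (κ : Type*) {m n : Type*} (Φ : Matrix m m ℂ →ₗ[ℂ] Matrix n n ℂ)
    (R : Matrix (κ × m) (κ × m) ℂ) : Matrix (κ × n) (κ × n) ℂ :=
  Matrix.of fun p q => Φ (Matrix.of fun i j => R (p.1, i) (q.1, j)) p.2 q.2

/-- A quantum channel: a completely positive and trace-preserving linear map. -/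
structure IsChannel {m n : Type*} [Fintype m] [Fintype n]
    (Φ : Matrix m m ℂ →ₗ[ℂ] Matrix n n ℂ) : Prop where
  completelyPositive : ∀ (k : ℕ) (R : Matrix (Fin k × m) (Fin k × m) ℂ),
    R.PosSemidef → (ampliation (Fin k) Φ R).PosSemidef
  tracePreserving : ∀ R : Matrix m m ℂ, (Φ R).trace = R.trace

/-- Partial trace over the first tensor factor. -/
def traceFirst {m n : Type*} [Fintype m] (R : Matrix (m × n) (m × n) ℂ) : Matrix n n ℂ :=
  Matrix.of fun i j => ∑ k, R (k, i) (k, j)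

/-! ### Two-point measurement experiments -/

/-- The devices, other than the memory, in a two-point measurement experiment without cross-talk,
with binary outcomes. The systems `A'`, `A`, `B`, `E'` have orthonormal bases indexed by
`ι'`, `ι`, `β`, `ε'`; the system `E` held in the memory is a qubit; `𝒳` is the set of settings of
the first measurement. -/
structure Experiment (𝒳 ι' ι β ε' : Type*) [Fintype ι'] [DecidableEq ι'] [Fintype ι]
    [DecidableEq ι] [Fintype β] [DecidableEq β] [Fintype ε'] [DecidableEq ε'] where
  /-- the initial state of `A' + E` -/
  state : Matrix (ι' × Fin 2) (ι' × Fin 2) ℂ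
  state_isDensity : IsDensity state
  /-- the first measurement: `povm x a` is the effect on `A'` of outcome `a` for setting `x` -/
  povm : 𝒳 → Fin 2 → Matrix ι' ι' ℂ
  povm_isPOVM : ∀ x, IsPOVM (povm x)
  /-- `prep a` is the state in which `A` is prepared after outcome `a` -/
  prep : Fin 2 → Matrix ι ι ℂ
  prep_isDensity : ∀ a, IsDensity (prep a)
  /-- the unitary evolution from `A + E` to `B + E'` -/
  U : Matrix (β × ε') (ι × Fin 2) ℂ
  U_isometry : Uᴴ * U = 1
  U_coisometry : U * Uᴴ = 1
  /-- the second measurement, on `B` -/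
  final : Fin 2 → Matrix β β ℂ
  final_isPOVM : IsPOVM final

section

variable {𝒳 ι' ι β ε' : Type*} [Fintype ι'] [DecidableEq ι'] [Fintype ι]
  [DecidableEq ι] [Fintype β] [DecidableEq β] [Fintype ε'] [DecidableEq ε']

/-- The unnormalised state of `A + E`, with `E` retrieved from the memory `M`, in the event that
the first measurement with setting `x` has given outcome `a`. -/
def Experiment.midState (T : Experiment 𝒳 ι' ι β ε')
    (M : Matrix (Fin 2) (Fin 2) ℂ →ₗ[ℂ] Matrix (Fin 2) (Fin 2) ℂ) (a : Fin 2) (x : 𝒳) :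
    Matrix (ι × Fin 2) (ι × Fin 2) ℂ :=
  T.prep a ⊗ₖ traceFirst ((T.povm x a ⊗ₖ (1 : Matrix (Fin 2) (Fin 2) ℂ)) * ampliation ι' M T.state)

/-- The Born rule for `Pr(A = a, B = b | X = x)` when the system `E` goes through the memory
channel `M`. -/
def Experiment.prob (T : Experiment 𝒳 ι' ι β ε')
    (M : Matrix (Fin 2) (Fin 2) ℂ →ₗ[ℂ] Matrix (Fin 2) (Fin 2) ℂ) (a b : Fin 2) (x : 𝒳) : ℝ :=
  ((T.final b ⊗ₖ (1 : Matrix ε' ε' ℂ)) * (T.U * T.midState M a x * T.Uᴴ)).trace.re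

end

/-- The quantity `Γ = ∑_{b₀,b₁} inf_x ∑_a Pr(A = a, B = b_a | X = x)` of a family of
distributions `P a b x = Pr(A = a, B = b | X = x)`. -/
def Gam {𝒳 : Type*} (P : Fin 2 → Fin 2 → 𝒳 → ℝ) : ℝ :=
  ∑ b₀ : Fin 2, ∑ b₁ : Fin 2, ⨅ x : 𝒳, ∑ a : Fin 2, P a (![b₀, b₁] a) x

/-! ### Fidelity of a qubit memory -/

/-- The maximally entangled two-qubit vector `|id⟩ = (|00⟩ + |11⟩)/√2`. -/
def idKet : Fin 2 × Fin 2 → ℂ := fun p => if p.1 = p.2 then ((√2 : ℝ) : ℂ)⁻¹ else 0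

/-- The normalised Choi state `(id ⊗ M)(|id⟩⟨id|)`. -/
def choiState (M : Matrix (Fin 2) (Fin 2) ℂ →ₗ[ℂ] Matrix (Fin 2) (Fin 2) ℂ) :
    Matrix (Fin 2 × Fin 2) (Fin 2 × Fin 2) ℂ :=
  ampliation (Fin 2) M (Matrix.vecMulVec idKet (star idKet))

/-- The fidelity `⟨id| (id ⊗ M)(|id⟩⟨id|) |id⟩` of the Choi state of `M` to that of the
identity channel. -/
def choiFidelity (M : Matrix (Fin 2) (Fin 2) ℂ →ₗ[ℂ] Matrix (Fin 2) (Fin 2) ℂ) : ℝ :=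
  (star idKet ⬝ᵥ (choiState M *ᵥ idKet)).re

/-- The unitary channel `R ↦ V R Vᴴ`. -/
def conjBy (V : Matrix (Fin 2) (Fin 2) ℂ) :
    Matrix (Fin 2) (Fin 2) ℂ →ₗ[ℂ] Matrix (Fin 2) (Fin 2) ℂ :=
  (LinearMap.mulRight ℂ Vᴴ).comp (LinearMap.mulLeft ℂ V)

/-- The fidelity of the memory `M` to an ideal memory. An ideal memory is reversible: it is the
identity channel up to a fixed unitary, which can be undone by the user. Hence the supremum over
the unitary `V` applied to the retrieved system; equivalently, the largest Choi-state fidelity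
of `M` to a unitary channel. -/
def memoryFidelity (M : Matrix (Fin 2) (Fin 2) ℂ →ₗ[ℂ] Matrix (Fin 2) (Fin 2) ℂ) : ℝ :=
  ⨆ V : Matrix.unitaryGroup (Fin 2) ℂ,
    choiFidelity ((conjBy (V : Matrix (Fin 2) (Fin 2) ℂ)).comp M)

/-- The constant `S_K = (8 + 7√2)/17`. -/
def SK : ℝ := (8 + 7 * √2) / 17

end TPM

end

/-! In the Bloch picture a qubit channel is an affine self-map `e ↦ t + T e` of the ball; let `S` be
the adjoint of `T`. Let `σ` be the reduced state of the qubit before storage and `r` its Bloch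
vector. The devices enter only through `β = 2(2 - Γ) = G₀(M(ω₀ + ω₁)) + G₁(M(ω₁ - ω₀))`, where the
`Gₐ` are two-outcome observables and `-σ ≤ ωᵢ ≤ σ` (`exists_chsh_eq_Gam`). Thus `Γ < 1` is a CHSH
violation `β > 2`.

When an observable or a steered operator may be replaced by a trivial one, `β ≤ 2`. A violation
therefore allows the `Gₐ` to be replaced by unit Bloch vectors, whose half-sum and half-difference
are orthogonal. For an observable whose pullback by the channel is indefinite, `pairing_le_sqrt`
bounds the value over `ω`; the square of this bound is a quadratic form in the Bloch vector
(`steeringForm`). By Cauchy–Schwarz `β/2` is at most the root of the trace of this form on a plane.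

That trace does not depend on the orthonormal basis of the plane, so the basis `m, n` can be chosen
with `S m ⟂ S n`. With `ν = ‖S m‖ + ‖S n‖`, the condition that the pure state in the direction of
`r` stays in the ball yields `β/2 ≤ SK + (√2 - SK)(ν - 1)` (`sum_sq_bound`, `sqrt_le_affine`).

On the other side, positivity of the Choi state gives memory fidelity at least `ν/2`, once a unitary
has aligned the input directions with the output directions (`memoryFidelity_ge`). Eliminating `ν`
gives the claim. -/

noncomputable section

namespace TPM

/-! ### A CHSH bound for affine maps of the Bloch ball -/

section InnerProduct

variable {E : Type*} [NormedAddCommGroup E] [InnerProductSpace ℝ E]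

local notation "⟪" x ", " y "⟫" => inner ℝ x y

lemma exists_unit_inner_eq_norm [Nontrivial E] (x : E) : ∃ e : E, ‖e‖ = 1 ∧ ⟪e, x⟫ = ‖x‖ := by
  by_cases hx : x = 0
  · obtain ⟨e, he⟩ := exists_norm_eq E (zero_le_one)
    exact ⟨e, he, by simp [hx]⟩
  · have h0 : ‖x‖ ≠ 0 := norm_ne_zero_iff.mpr hx
    refine ⟨(‖x‖)⁻¹ • x, by simp [norm_smul, h0], ?_⟩
    rw [real_inner_smul_left, real_inner_self_eq_norm_sq]
    field_simp

lemma eq_norm_smul_of_inner_eq_norm {e x : E} (he : ‖e‖ = 1) (h : ⟪e, x⟫ = ‖x‖) :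
    x = ‖x‖ • e := by
  have h1 : ‖x - ‖x‖ • e‖ ^ 2 = 0 := by
    rw [norm_sub_sq_real, real_inner_smul_right, real_inner_comm, h, norm_smul, he]
    simp
    ring
  exact sub_eq_zero.mp (by simpa using h1)

/-- Self-duality of the light cone; every positivity argument on Bloch vectors below rests on it. -/
lemma mul_add_inner_nonneg {x y : ℝ} {v w : E} (hv : ‖v‖ ≤ x) (hw : ‖w‖ ≤ y) :
    0 ≤ x * y + ⟪v, w⟫ := by
  have h1 := (abs_le.mp (abs_real_inner_le_norm v w)).1
  have h2 := mul_le_mul hv hw (norm_nonneg _) ((norm_nonneg _).trans hv)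
  linarith

lemma norm_smul_sub_smul_sq (x y : ℝ) (v w : E) :
    ‖x • v - y • w‖ ^ 2 = x ^ 2 * ‖v‖ ^ 2 - 2 * x * y * ⟪v, w⟫ + y ^ 2 * ‖w‖ ^ 2 := by
  rw [norm_sub_sq_real, norm_smul, norm_smul, real_inner_smul_left, real_inner_smul_right,
    mul_pow, mul_pow, Real.norm_eq_abs, Real.norm_eq_abs, sq_abs, sq_abs]
  ring

/-- `(a; w)` is dominated by the state with Bloch vector `r`: both `(1 + a; r + w)` and
`(1 - a; r - w)` lie in the forward light cone. -/
def Dominated (r : E) (a : ℝ) (w : E) : Prop := ‖r + w‖ ≤ 1 + a ∧ ‖r - w‖ ≤ 1 - a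

lemma Dominated.norm_le_one {r w : E} {a : ℝ} (h : Dominated r a w) : ‖r‖ ≤ 1 := by
  have h1 : (2 : ℝ) • r = (r + w) + (r - w) := by module
  have h2 : ‖(2 : ℝ) • r‖ = 2 * ‖r‖ := by rw [norm_smul]; norm_num
  have h3 := norm_add_le (r + w) (r - w)
  rw [← h1, h2] at h3
  linarith [h.1, h.2]

lemma Dominated.neg {r w : E} {a : ℝ} (h : Dominated r a w) : Dominated r (-a) (-w) :=
  ⟨by simpa [← sub_eq_add_neg] using h.2, by simpa using h.1⟩

/-- For a positive observable the best dominated vector is the state `(1; r)` itself. -/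
lemma Dominated.pairing_le {r w h : E} {a η : ℝ} (hd : Dominated r a w) (hη : ‖h‖ ≤ η) :
    η * a + ⟪h, w⟫ ≤ η + ⟪h, r⟫ := by
  have := mul_add_inner_nonneg hd.2 hη
  rw [real_inner_comm, inner_sub_right] at this
  linarith

/-- Pairing a dominated vector with a bounded observable. -/
lemma Dominated.pairing_le_one {r w h : E} {a η : ℝ} (hd : Dominated r a w)
    (hη : |η| + ‖h‖ ≤ 1) : η * a + ⟪h, w⟫ ≤ 1 := by
  have h1 := mul_add_inner_nonneg hd.1 (w := -h) (y := 1 - η)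
    (by rw [norm_neg]; linarith [le_abs_self η])
  have h2 := mul_add_inner_nonneg hd.2 (w := h) (y := 1 + η)
    (by linarith [neg_abs_le η])
  rw [real_inner_comm] at h1 h2
  simp only [inner_neg_left, inner_add_right, inner_sub_right] at h1 h2
  linarith

/-- The largest value of the pairing of a dominated vector with an indefinite observable. -/
lemma Dominated.pairing_le_sqrt {r w h : E} {a η : ℝ} (hd : Dominated r a w) (hη : |η| < ‖h‖) :
    η * a + ⟪h, w⟫ ≤ √((η + ⟪h, r⟫) ^ 2 + (1 - ‖r‖ ^ 2) * (‖h‖ ^ 2 - η ^ 2)) := by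
  have hr := hd.norm_le_one
  set ρ := η + ⟪h, r⟫ with hρ
  set D := ‖h‖ ^ 2 - η ^ 2 with hD
  have hD0 : 0 < D := by
    have := sq_lt_sq' (by linarith [abs_nonneg η]) hη
    rw [sq_abs] at this
    linarith
  have hN : 0 ≤ 1 - ‖r‖ ^ 2 := by nlinarith [norm_nonneg r]
  set R := ρ ^ 2 + (1 - ‖r‖ ^ 2) * D with hR
  have hR0 : 0 ≤ R := by positivity
  have hss : √R ^ 2 = R := Real.sq_sqrt hR0
  set s := √R with hs
  have hs0 : 0 ≤ s := Real.sqrt_nonneg _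
  rcases hs0.eq_or_lt with hs1 | hs1
  -- Degenerate case: `r` is pure with zero expectation `ρ`. A vector dominated by a pure state is a
  -- multiple of it, so the pairing vanishes.
  · have hR1 : R = 0 := by rw [← hss, ← hs1]; ring
    have hρ0 : ρ = 0 := by
      have : ρ ^ 2 = 0 := by nlinarith [mul_nonneg hN hD0.le, sq_nonneg ρ]
      simpa using this
    have hN0 : ‖r‖ ^ 2 = 1 := by
      have : (1 - ‖r‖ ^ 2) * D = 0 := by nlinarith [mul_nonneg hN hD0.le, sq_nonneg ρ]
      rcases mul_eq_zero.mp this with h | h <;> linarith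
    have h1 := pow_le_pow_left₀ (norm_nonneg _) hd.1 2
    have h2 := pow_le_pow_left₀ (norm_nonneg _) hd.2 2
    rw [norm_add_sq_real, hN0] at h1
    rw [norm_sub_sq_real, hN0] at h2
    have ha1 : -1 ≤ a := by linarith [(norm_nonneg _).trans hd.1]
    have ha2 : a ≤ 1 := by linarith [(norm_nonneg _).trans hd.2]
    have h3 := norm_smul_sub_smul_sq 1 a w r
    rw [real_inner_comm, one_smul, hN0] at h3
    have h4 : ‖w - a • r‖ ^ 2 ≤ 0 := by nlinarith
    have h5 : w = a • r := by
      have : ‖w - a • r‖ = 0 := by simpa using le_antisymm h4 (sq_nonneg _)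
      exact sub_eq_zero.mp (norm_eq_zero.mp this)
    rw [h5, inner_smul_right, ← hs1]
    have : η * a + a * ⟪h, r⟫ = a * ρ := by rw [hρ]; ring
    simp [this, hρ0]
  · have hk : 0 ≤ ρ * η + D := by
      have h1 := (abs_le.mp (abs_real_inner_le_norm h r))
      have h2 : |η * ⟪h, r⟫| ≤ ‖h‖ * ‖h‖ := by
        rw [abs_mul]
        refine mul_le_mul hη.le ?_ (abs_nonneg _) (norm_nonneg _)
        refine (abs_real_inner_le_norm h r).trans ?_
        nlinarith [norm_nonneg h]
      have h3 := (abs_le.mp h2).1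
      rw [hρ, hD]
      nlinarith
    have hk2 : |s * η| ≤ ρ * η + D := by
      refine abs_le_of_sq_le_sq ?_ hk
      have h1 := norm_smul_sub_smul_sq 1 (-η) h r
      have h2 : (ρ * η + D) ^ 2 - (s * η) ^ 2 = D * ‖(1 : ℝ) • h - (-η) • r‖ ^ 2 := by
        rw [mul_pow, hss, h1, hR, hρ, hD]; ring
      have : 0 ≤ D * ‖(1 : ℝ) • h - (-η) • r‖ ^ 2 := by positivity
      linarith
    -- Dual certificate: for `x = ±s` these are two vectors on the boundary of the light cone whose
    -- difference is `2s(η; h)`. Pairing them with `(1 - a; r - w)` and `(1 + a; r + w)` and adding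
    -- gives the bound multiplied by `s`.
    have key : ∀ x : ℝ, x ^ 2 = s ^ 2 → 0 ≤ ρ * η + D + x * η →
        ‖(ρ + x) • h - D • r‖ ≤ ρ * η + D + x * η := by
      intro x hx hx0
      refine abs_le_of_sq_le_sq' ?_ hx0 |>.2
      rw [norm_smul_sub_smul_sq]
      apply le_of_eq
      have : ⟪h, r⟫ = ρ - η := by rw [hρ]; ring
      rw [this]
      have h4 : ‖h‖ ^ 2 = D + η ^ 2 := by rw [hD]; ring
      have h5 : x ^ 2 = ρ ^ 2 + (1 - ‖r‖ ^ 2) * D := by rw [hx, hss]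
      rw [h4]
      linear_combination D * h5
    have e1 := mul_add_inner_nonneg hd.2 (key s rfl (by linarith [(abs_le.mp hk2).1]))
    have e2 := mul_add_inner_nonneg hd.1
      (key (-s) (by ring) (by linarith [(abs_le.mp hk2).2]))
    rw [real_inner_comm] at e1 e2
    simp only [inner_sub_left, inner_sub_right, inner_add_right, real_inner_smul_left] at e1 e2
    rw [real_inner_self_eq_norm_sq] at e1 e2
    have e3 : s * (η * a + ⟪h, w⟫) ≤ s * s := by
      rw [← pow_two, hss, hR]
      have : ⟪h, r⟫ = ρ - η := by rw [hρ]; ring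
      rw [this] at e1 e2
      nlinarith
    exact le_of_mul_le_mul_left e3 hs1

/-- A quarter turn changes the sign of the inner product, so it vanishes at some angle in between.
-/
lemma exists_rotation_inner_eq_zero (x y : E) :
    ∃ c s : ℝ, c ^ 2 + s ^ 2 = 1 ∧ ⟪c • x + s • y, (-s) • x + c • y⟫ = 0 := by
  let f : ℝ → ℝ := fun φ =>
    ⟪Real.cos φ • x + Real.sin φ • y, (-Real.sin φ) • x + Real.cos φ • y⟫
  have hf : Continuous f := by
    simp only [f]; fun_prop
  have h0 : f 0 = ⟪x, y⟫ := by simp [f]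
  have h1 : f (Real.pi / 2) = -⟪x, y⟫ := by simp [f, real_inner_comm]
  have : (0 : ℝ) ∈ Set.uIcc (f 0) (f (Real.pi / 2)) := by
    rw [h0, h1, Set.mem_uIcc]
    rcases le_total 0 ⟪x, y⟫ with h | h
    · right; constructor <;> linarith
    · left; constructor <;> linarith
  obtain ⟨φ, -, hφ⟩ := intermediate_value_uIcc hf.continuousOn this
  exact ⟨Real.cos φ, Real.sin φ, Real.cos_sq_add_sin_sq φ, hφ⟩

end InnerProduct

/-! ### The scalar estimates -/

/-- Here `r = μ e` with `‖e‖ = 1`. The first pair of terms equals `μ²(p + A)² + 2μ(1 - μ)pA + (1 -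
μ²)a²`, and similarly for the second. The squares are controlled by the image of `e`, the cross
terms by `|p| ≤ 1 - a` and `|A| ≤ a`. -/
lemma sum_sq_bound {μ p q A B a b : ℝ} (hμ0 : 0 ≤ μ) (hμ1 : μ ≤ 1)
    (hp : |p| + a ≤ 1) (hq : |q| + b ≤ 1)
    (hA : |A| ≤ a) (hB : |B| ≤ b) (hAB : (p + A) ^ 2 + (q + B) ^ 2 ≤ 1) :
    (p + μ * A) ^ 2 + (1 - μ ^ 2) * (a ^ 2 - p ^ 2)
      + ((q + μ * B) ^ 2 + (1 - μ ^ 2) * (b ^ 2 - q ^ 2))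
      ≤ 1 + (1 - μ) ^ 2 * (a ^ 2 + b ^ 2 - 1) + 2 * μ * (1 - μ) * (a + b - 1) := by
  have h1 : p * A ≤ (1 - a) * a := by
    refine (le_abs_self _).trans ?_
    rw [abs_mul]
    exact mul_le_mul (by linarith) hA (abs_nonneg _) (by linarith [abs_nonneg p])
  have h2 : q * B ≤ (1 - b) * b := by
    refine (le_abs_self _).trans ?_
    rw [abs_mul]
    exact mul_le_mul (by linarith) hB (abs_nonneg _) (by linarith [abs_nonneg q])
  have h3 : 0 ≤ 2 * μ * (1 - μ) := by nlinarith
  have h4 := mul_le_mul_of_nonneg_left (add_le_add h1 h2) h3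
  have h5 := mul_le_mul_of_nonneg_left hAB (sq_nonneg μ)
  nlinarith

lemma SK_ge : (1.05 : ℝ) ≤ SK := by
  have : (1.41 : ℝ) ≤ √2 := Real.le_sqrt_of_sq_le (by norm_num)
  unfold SK
  linarith

lemma SK_lt_sqrt_two : SK < √2 := by
  have : (1.41 : ℝ) ≤ √2 := Real.le_sqrt_of_sq_le (by norm_num)
  unfold SK
  linarith

lemma sqrt_le_affine {μ δ : ℝ} (hδ0 : 0 ≤ δ) (hδ1 : δ ≤ 1) :
    √(1 + (1 - μ) ^ 2 * δ ^ 2 + 2 * μ * (1 - μ) * δ) ≤ SK + (√2 - SK) * δ := by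
  have h2 : (1.41 : ℝ) ≤ √2 := Real.le_sqrt_of_sq_le (by norm_num)
  have hsq : √2 ^ 2 = 2 := Real.sq_sqrt (by norm_num)
  -- Both affine functions equal `√2` at `δ = 1`, so only the value at `δ = 0` matters; the rational
  -- `1.05 ≤ SK` already suffices.
  have h3 : 1.05 * (1 - δ) + √2 * δ ≤ SK + (√2 - SK) * δ := by
    nlinarith [SK_ge]
  refine (Real.sqrt_le_iff.mpr ⟨by nlinarith, ?_⟩).trans h3
  -- The right side minus the left is `δ(μ - (1 - δ))² + μ²δ(1 - δ)`.
  have h4 : (1 - μ) ^ 2 * δ ^ 2 + 2 * μ * (1 - μ) * δ ≤ δ ^ 2 + δ * (1 - δ) ^ 2 := by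
    have : 0 ≤ δ * (μ - (1 - δ)) ^ 2 := by positivity
    have : 0 ≤ μ ^ 2 * (δ * (1 - δ)) := mul_nonneg (sq_nonneg _) (mul_nonneg hδ0 (by linarith))
    nlinarith
  have h5 : 0 ≤ (1 - δ) * (0.1025 - 0.1415 * δ + δ ^ 2) := by
    refine mul_nonneg (by linarith) ?_
    nlinarith [sq_nonneg (δ - 0.07075)]
  have h6 : 1.41 * (δ * (1 - δ)) ≤ √2 * (δ * (1 - δ)) :=
    mul_le_mul_of_nonneg_right h2 (mul_nonneg hδ0 (by linarith))
  have h7 : (1.05 * (1 - δ) + √2 * δ) ^ 2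
      = 1.1025 * (1 - δ) ^ 2 + 2.1 * (√2 * (δ * (1 - δ))) + 2 * δ ^ 2 := by
    linear_combination δ ^ 2 * hsq
  rw [h7]
  nlinarith

/-! ### Affine maps of the ball and the steering form -/

section InnerProduct

variable {E : Type*} [NormedAddCommGroup E] [InnerProductSpace ℝ E]

local notation "⟪" x ", " y "⟫" => inner ℝ x y

/-- The affine map `e ↦ t + T e` sends the unit sphere into the unit ball, and `S` is the adjoint
of `T`. -/
structure IsBallMap (t : E) (T S : E →ₗ[ℝ] E) : Prop where
  adjoint : ∀ x y, ⟪T x, y⟫ = ⟪x, S y⟫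
  norm_le : ∀ e : E, ‖e‖ = 1 → ‖t + T e‖ ≤ 1

/-- The square of the largest value at the effect `g` of a vector dominated by the state `r`. -/
def steeringForm (t : E) (S : E →ₗ[ℝ] E) (r g : E) : ℝ :=
  (⟪t, g⟫ + ⟪S g, r⟫) ^ 2 + (1 - ‖r‖ ^ 2) * (‖S g‖ ^ 2 - ⟪t, g⟫ ^ 2)

lemma steeringForm_smul (t : E) (S : E →ₗ[ℝ] E) (r g : E) (x : ℝ) :
    steeringForm t S r (x • g) = x ^ 2 * steeringForm t S r g := by
  simp only [steeringForm, map_smul, real_inner_smul_left, real_inner_smul_right, norm_smul,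
    mul_pow, Real.norm_eq_abs, sq_abs]
  ring

/-- The form is quadratic in `g`, so its trace on a plane is the same in every orthonormal basis. -/
lemma steeringForm_rotate (t : E) (S : E →ₗ[ℝ] E) (r m n : E) {c s : ℝ} (hcs : c ^ 2 + s ^ 2 = 1) :
    steeringForm t S r (c • m + s • n) + steeringForm t S r ((-s) • m + c • n)
      = steeringForm t S r m + steeringForm t S r n := by
  have key : ∀ x y : E, ∀ c s : ℝ, ‖c • x + s • y‖ ^ 2
      = c ^ 2 * ‖x‖ ^ 2 + 2 * c * s * ⟪x, y⟫ + s ^ 2 * ‖y‖ ^ 2 := by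
    intro x y c s
    rw [norm_add_sq_real, norm_smul, norm_smul, real_inner_smul_left, real_inner_smul_right,
      mul_pow, mul_pow, Real.norm_eq_abs, Real.norm_eq_abs, sq_abs, sq_abs]
    ring
  simp only [steeringForm, map_add, map_smul, key, inner_add_left, inner_add_right,
    real_inner_smul_left, real_inner_smul_right]
  linear_combination ((⟪t, m⟫ + ⟪S m, r⟫) ^ 2 + (1 - ‖r‖ ^ 2) * (‖S m‖ ^ 2 - ⟪t, m⟫ ^ 2)
    + (⟪t, n⟫ + ⟪S n, r⟫) ^ 2 + (1 - ‖r‖ ^ 2) * (‖S n‖ ^ 2 - ⟪t, n⟫ ^ 2)) * hcs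

namespace IsBallMap

variable {t : E} {T S : E →ₗ[ℝ] E}

/-- The Heisenberg dual of the map sends observables to observables: evaluate at the pure states
`±e` with `e` along `S g`. -/
lemma effect_bound [Nontrivial E] (hM : IsBallMap t T S) (g : E) :
    |⟪t, g⟫| + ‖S g‖ ≤ ‖g‖ := by
  obtain ⟨e, he, heS⟩ := exists_unit_inner_eq_norm (S g)
  have h1 : ∀ e' : E, ‖e'‖ = 1 → |⟪t, g⟫ + ⟪e', S g⟫| ≤ ‖g‖ := by
    intro e' he'
    rw [← hM.adjoint, ← inner_add_left]
    refine (abs_real_inner_le_norm _ _).trans ?_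
    exact mul_le_of_le_one_left (norm_nonneg _) (hM.norm_le e' he')
  have h2 := abs_le.mp (h1 e he)
  have h3 := abs_le.mp (h1 (-e) (by rwa [norm_neg]))
  rw [inner_neg_left, heS] at h3
  rw [heS] at h2
  rcases abs_cases ⟪t, g⟫ with h | h <;> rw [h.1] <;> linarith

lemma inner_image (hM : IsBallMap t T S) (g w : E) (a : ℝ) :
    ⟪g, a • t + T w⟫ = ⟪t, g⟫ * a + ⟪S g, w⟫ := by
  rw [inner_add_right, real_inner_smul_right, real_inner_comm (T w) g, hM.adjoint,
    real_inner_comm t g, real_inner_comm w]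
  ring

variable {r w₀ w₁ : E} {a₀ a₁ : ℝ}

lemma inner_image_le_one [Nontrivial E] (hM : IsBallMap t T S) (h₀ : Dominated r a₀ w₀) {g : E}
    (hg : ‖g‖ ≤ 1) : ⟪g, a₀ • t + T w₀⟫ ≤ 1 := by
  rw [hM.inner_image]
  exact h₀.pairing_le_one ((hM.effect_bound g).trans hg)

end IsBallMap

/-! ### Configurations that cannot violate CHSH -/

section classical

variable {r w₀ w₁ : E} {a₀ a₁ : ℝ}

/-- The CHSH bound is classical if one of the observables on the receiving side is trivial. -/
lemma classical_of_trivial_observable (h₀ : Dominated r a₀ w₀) (h₁ : Dominated r a₁ w₁)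
    {η : ℝ} {h : E} (hη : |η| + ‖h‖ ≤ 1) :
    |a₀ + a₁| + (η * (a₁ - a₀) + ⟪h, w₁ - w₀⟫) ≤ 2 := by
  -- The observables `(1 + η; h)` and `(1 - η; -h)` are positive and add up to `2`; each is
  -- maximised at the state.
  have e1 : ‖h‖ ≤ 1 + η := by linarith [neg_abs_le η]
  have e2 : ‖-h‖ ≤ 1 - η := by rw [norm_neg]; linarith [le_abs_self η]
  rcases abs_cases (a₀ + a₁) with h | h <;> rw [h.1]
  · have := h₁.pairing_le e1
    have := h₀.pairing_le e2
    simp only [inner_neg_left, inner_sub_right] at *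
    linarith
  · have := h₁.neg.pairing_le e2
    have := h₀.neg.pairing_le e1
    simp only [inner_neg_left, inner_neg_right, inner_sub_right] at *
    linarith

/-- The CHSH bound is classical if one of the observables on the sending side is trivial. -/
lemma classical_of_trivial_steering (h₀ : Dominated r a₀ w₀) {η₀ η₁ : ℝ} {k₀ k₁ : E}
    (hk₀ : |η₀| + ‖k₀‖ ≤ 1) (hk₁ : |η₁| + ‖k₁‖ ≤ 1) :
    |(η₀ + η₁) + ⟪k₀ + k₁, r⟫| + ((η₀ - η₁) * a₀ + ⟪k₀ - k₁, w₀⟫) ≤ 2 := by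
  have e : ∀ {η : ℝ} {k : E}, |η| + ‖k‖ ≤ 1 → ‖k‖ ≤ 1 + η ∧ ‖-k‖ ≤ 1 - η := by
    intro η k h
    rw [norm_neg]
    exact ⟨by linarith [neg_abs_le η], by linarith [le_abs_self η]⟩
  -- With `σ` standing for the trivial steered operator, the value is `K₀(σ + ω) + K₁(σ - ω)`, at
  -- most the total trace `2`. The other sign exchanges `K₀` and `K₁` and negates both.
  have f1 := mul_add_inner_nonneg h₀.1 (e hk₀).2
  have f2 := mul_add_inner_nonneg h₀.2 (e hk₁).2
  have f3 := mul_add_inner_nonneg h₀.2 (e hk₀).1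
  have f4 := mul_add_inner_nonneg h₀.1 (e hk₁).1
  simp only [inner_neg_right, inner_add_left, inner_sub_left, inner_add_right, inner_sub_right,
    real_inner_comm k₀, real_inner_comm k₁] at *
  rcases abs_cases ((η₀ + η₁) + (⟪k₀, r⟫ + ⟪k₁, r⟫)) with h | h <;> rw [h.1] <;> linarith

end classical

lemma mul_sqrt_add_mul_sqrt_le {c s x y : ℝ} (hcs : c ^ 2 + s ^ 2 = 1) (hx : 0 ≤ x) (hy : 0 ≤ y) :
    c * √x + s * √y ≤ √(x + y) := by
  refine Real.le_sqrt_of_sq_le ?_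
  have hx' := Real.sq_sqrt hx
  have hy' := Real.sq_sqrt hy
  nlinarith [sq_nonneg (c * √y - s * √x)]

/-! ### From a CHSH violation to a large nuclear norm -/

namespace IsBallMap

variable {t : E} {T S : E →ₗ[ℝ] E} {r w₀ w₁ : E} {a₀ a₁ : ℝ}

/-- An indefinite effect, or one which behaves classically. -/
lemma inner_image_le_abs_or_sqrt (hM : IsBallMap t T S) (h₀ : Dominated r a₀ w₀) (g : E) :
    ⟪g, a₀ • t + T w₀⟫ ≤ |⟪t, g⟫ + ⟪S g, r⟫| ∨
      (0 ≤ steeringForm t S r g ∧ ⟪g, a₀ • t + T w₀⟫ ≤ √(steeringForm t S r g)) := by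
  rw [hM.inner_image]
  rcases lt_or_ge |⟪t, g⟫| ‖S g‖ with h | h
  · right
    refine ⟨?_, h₀.pairing_le_sqrt h⟩
    have h1 : 0 ≤ 1 - ‖r‖ ^ 2 := by nlinarith [norm_nonneg r, h₀.norm_le_one]
    have h2 : ⟪t, g⟫ ^ 2 ≤ ‖S g‖ ^ 2 := sq_le_sq' (by linarith [neg_abs_le ⟪t, g⟫])
      ((le_abs_self _).trans h.le)
    unfold steeringForm
    have := mul_nonneg h1 (sub_nonneg.mpr h2)
    positivity
  · left
    rcases le_total 0 ⟪t, g⟫ with h' | h'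
    · rw [abs_of_nonneg h'] at h
      exact (h₀.pairing_le h).trans (le_abs_self _)
    · rw [abs_of_nonpos h'] at h
      have := h₀.neg.pairing_le (η := -⟪t, g⟫) (h := -S g) (by rwa [norm_neg])
      simp only [inner_neg_left, inner_neg_right] at this
      refine le_trans ?_ (neg_abs_le _ |> neg_le.mp)
      linarith

/-- A violation of the CHSH inequality is governed by the steering form on an orthonormal pair. -/
lemma exists_orthonormal_of_unit [Nontrivial E] (hM : IsBallMap t T S)
    (h₀ : Dominated r a₀ w₀) (h₁ : Dominated r a₁ w₁) {g₀ g₁ : E} (hg₀ : ‖g₀‖ = 1)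
    (hg₁ : ‖g₁‖ = 1)
    (hβ : 2 < ⟪g₀, (a₀ + a₁) • t + T (w₀ + w₁)⟫ + ⟪g₁, (a₁ - a₀) • t + T (w₁ - w₀)⟫) :
    ∃ m n : E, ‖m‖ = 1 ∧ ‖n‖ = 1 ∧ ⟪m, n⟫ = 0 ∧
      (⟪g₀, (a₀ + a₁) • t + T (w₀ + w₁)⟫ + ⟪g₁, (a₁ - a₀) • t + T (w₁ - w₀)⟫) / 2
        ≤ √(steeringForm t S r m + steeringForm t S r n) := by
  set β := ⟪g₀, (a₀ + a₁) • t + T (w₀ + w₁)⟫ + ⟪g₁, (a₁ - a₀) • t + T (w₁ - w₀)⟫ with hβdef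
  -- Regrouping by `ω₁` and `ω₀` turns the unit vectors `g₀, g₁` into an orthogonal pair with `‖p‖²
  -- + ‖q‖² = 1`, the weights for Cauchy–Schwarz.
  set p := (1 / 2 : ℝ) • (g₀ + g₁) with hp
  set q := (1 / 2 : ℝ) • (g₀ - g₁) with hq
  have hβ2 : β / 2 = ⟪p, a₁ • t + T w₁⟫ + ⟪q, a₀ • t + T w₀⟫ := by
    rw [hβdef, hp, hq, map_add, map_sub]
    simp only [inner_add_left, inner_sub_left, inner_add_right, inner_sub_right,
      real_inner_smul_left, real_inner_smul_right]
    ring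
  have hpq : ⟪p, q⟫ = 0 := by
    rw [hp, hq]
    simp only [inner_add_left, inner_sub_right,
      real_inner_smul_left, real_inner_smul_right, real_inner_self_eq_norm_sq, hg₀, hg₁,
      real_inner_comm g₀ g₁]
    ring
  have hpq1 : ‖p‖ ^ 2 + ‖q‖ ^ 2 = 1 := by
    rw [hp, hq, norm_smul, norm_smul, mul_pow, mul_pow, norm_add_sq_real, norm_sub_sq_real,
      hg₀, hg₁]
    norm_num
    ring
  have hp1 : ‖p‖ ≤ 1 := by nlinarith [norm_nonneg p, sq_nonneg ‖q‖]
  have hq1 : ‖q‖ ≤ 1 := by nlinarith [norm_nonneg q, sq_nonneg ‖p‖]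
  have hp0 : p ≠ 0 := by
    intro h
    have := hM.inner_image_le_one h₀ hq1
    rw [h, inner_zero_left] at hβ2
    linarith
  have hq0 : q ≠ 0 := by
    intro h
    have := hM.inner_image_le_one h₁ hp1
    rw [h, inner_zero_left] at hβ2
    linarith
  have e₀ := (hM.effect_bound g₀).trans hg₀.le
  have e₁ := (hM.effect_bound g₁).trans hg₁.le
  have htp : ⟪t, p⟫ = (⟪t, g₀⟫ + ⟪t, g₁⟫) / 2 := by
    rw [hp, real_inner_smul_right, inner_add_right]; ring
  have htq : ⟪t, q⟫ = (⟪t, g₀⟫ - ⟪t, g₁⟫) / 2 := by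
    rw [hq, real_inner_smul_right, inner_sub_right]; ring
  have hSp : ∀ z, ⟪S p, z⟫ = 1 / 2 * ⟪S g₀ + S g₁, z⟫ := fun z => by
    rw [hp, map_smul, map_add, real_inner_smul_left]
  have hSq : ∀ z, ⟪S q, z⟫ = 1 / 2 * ⟪S g₀ - S g₁, z⟫ := fun z => by
    rw [hq, map_smul, map_sub, real_inner_smul_left]
  have habs : ∀ x y : ℝ, |x / 2 + 1 / 2 * y| = |x + y| / 2 := by
    intro x y
    rw [show x / 2 + 1 / 2 * y = (x + y) / 2 by ring, abs_div, abs_two]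
  -- If the pullback of `p` or `q` is definite, the matching steered operator is no better than `±σ`
  -- and `β ≤ 2`.
  rcases hM.inner_image_le_abs_or_sqrt h₁ p with c1 | ⟨c1, c2⟩
  · exfalso
    have := classical_of_trivial_steering h₀ e₀ e₁
    rw [htp, hSp, habs] at c1
    rw [hM.inner_image q, htq, hSq] at hβ2
    linarith
  rcases hM.inner_image_le_abs_or_sqrt h₀ q with d1 | ⟨d1, d2⟩
  · exfalso
    have := classical_of_trivial_steering h₁ (η₁ := -⟪t, g₁⟫) (k₁ := -S g₁) e₀
      (by rwa [abs_neg, norm_neg])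
    rw [htq, hSq, habs] at d1
    rw [hM.inner_image p, htp, hSp] at hβ2
    simp only [← sub_eq_add_neg, sub_neg_eq_add] at this
    linarith
  have hpn : ‖p‖ ≠ 0 := norm_ne_zero_iff.mpr hp0
  have hqn : ‖q‖ ≠ 0 := norm_ne_zero_iff.mpr hq0
  have hpm : p = ‖p‖ • ((‖p‖)⁻¹ • p) := by rw [smul_smul, mul_inv_cancel₀ hpn, one_smul]
  have hqm : q = ‖q‖ • ((‖q‖)⁻¹ • q) := by rw [smul_smul, mul_inv_cancel₀ hqn, one_smul]
  have hm1 : ‖(‖p‖)⁻¹ • p‖ = 1 := by simp [norm_smul, hpn]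
  have hn1 : ‖(‖q‖)⁻¹ • q‖ = 1 := by simp [norm_smul, hqn]
  have hmn : ⟪(‖p‖)⁻¹ • p, (‖q‖)⁻¹ • q⟫ = 0 := by
    rw [real_inner_smul_left, real_inner_smul_right, hpq]; simp
  generalize (‖p‖)⁻¹ • p = m at *
  generalize (‖q‖)⁻¹ • q = n at *
  refine ⟨m, n, hm1, hn1, hmn, ?_⟩
  have fp : steeringForm t S r p = ‖p‖ ^ 2 * steeringForm t S r m := by
    conv_lhs => rw [hpm]
    exact steeringForm_smul ..
  have fq : steeringForm t S r q = ‖q‖ ^ 2 * steeringForm t S r n := by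
    conv_lhs => rw [hqm]
    exact steeringForm_smul ..
  rw [fp] at c1 c2
  rw [fq] at d1 d2
  rw [Real.sqrt_mul (sq_nonneg _), Real.sqrt_sq (norm_nonneg _)] at c2 d2
  have := mul_sqrt_add_mul_sqrt_le hpq1
    (nonneg_of_mul_nonneg_right c1 (by positivity)) (nonneg_of_mul_nonneg_right d1 (by positivity))
  linarith

/-- The steering form on an orthonormal pair is bounded by the nuclear norm of the adjoint on
that pair. -/
lemma exists_orthonormal_sqrt_le [Nontrivial E] (hM : IsBallMap t T S) {m n : E} (hr : ‖r‖ ≤ 1)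
    (hm : ‖m‖ = 1) (hn : ‖n‖ = 1) (hmn : ⟪m, n⟫ = 0)
    (hV : 1 < √(steeringForm t S r m + steeringForm t S r n)) :
    ∃ u v m' n' : E, ‖u‖ = 1 ∧ ‖v‖ = 1 ∧ ⟪u, v⟫ = 0 ∧ ‖m'‖ = 1 ∧ ‖n'‖ = 1 ∧ ⟪m', n'⟫ = 0 ∧
      √(steeringForm t S r m + steeringForm t S r n)
        ≤ SK + (√2 - SK) * (⟪m', T u⟫ + ⟪n', T v⟫ - 1) := by
  -- A singular value decomposition of `S` on the plane; the trace of the form is unaffected.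
  obtain ⟨c, s, hcs, hort⟩ := exists_rotation_inner_eq_zero (S m) (S n)
  rw [← steeringForm_rotate t S r m n hcs] at hV ⊢
  have unit : ∀ c s : ℝ, c ^ 2 + s ^ 2 = 1 → ‖c • m + s • n‖ = 1 := by
    intro c s hcs
    have : ‖c • m + s • n‖ ^ 2 = 1 := by
      rw [norm_add_sq_real, norm_smul, norm_smul, real_inner_smul_left, real_inner_smul_right,
        hm, hn, hmn, mul_pow, mul_pow, Real.norm_eq_abs, Real.norm_eq_abs, sq_abs, sq_abs]
      linarith
    exact (pow_eq_one_iff_of_nonneg (norm_nonneg _) two_ne_zero).mp this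
  have hm' := unit c s hcs
  have hn' := unit (-s) c (by rw [neg_sq]; linarith)
  have hmn' : ⟪c • m + s • n, (-s) • m + c • n⟫ = 0 := by
    simp only [inner_add_left, inner_add_right, real_inner_smul_left, real_inner_smul_right,
      real_inner_self_eq_norm_sq, hm, hn, hmn, real_inner_comm m n]
    ring
  rw [← map_smul, ← map_smul, ← map_add, ← map_smul, ← map_smul, ← map_add] at hort
  generalize c • m + s • n = m' at *
  generalize (-s) • m + c • n = n' at *
  clear hm hn hmn
  obtain ⟨e, he, her⟩ := exists_unit_inner_eq_norm r
  have hre := eq_norm_smul_of_inner_eq_norm he her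
  -- Bessel's inequality for the image of the pure state `e` in the direction of `r`.
  have hpos : (⟪t, m'⟫ + ⟪S m', e⟫) ^ 2 + (⟪t, n'⟫ + ⟪S n', e⟫) ^ 2 ≤ 1 := by
    have h1 := hM.norm_le e he
    rw [real_inner_comm e (S m'), real_inner_comm e (S n'), ← hM.adjoint, ← hM.adjoint,
      ← inner_add_left, ← inner_add_left]
    have h2 : Orthonormal ℝ ![m', n'] := by
      rw [orthonormal_iff_ite]
      intro i j
      fin_cases i <;> fin_cases j <;> simp [hm', hn', hmn', real_inner_comm m' n']
    have h3 := h2.sum_inner_products_le (t + T e) (s := Finset.univ)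
    simp only [Fin.sum_univ_two, Matrix.cons_val_zero, Matrix.cons_val_one, Real.norm_eq_abs,
      sq_abs] at h3
    rw [real_inner_comm m', real_inner_comm n']
    refine h3.trans ?_
    exact pow_le_one₀ (norm_nonneg _) h1
  have hA : |⟪S m', e⟫| ≤ ‖S m'‖ := by
    simpa [he] using abs_real_inner_le_norm (S m') e
  have hB : |⟪S n', e⟫| ≤ ‖S n'‖ := by
    simpa [he] using abs_real_inner_le_norm (S n') e
  have hp := (hM.effect_bound m').trans hm'.le
  have hq := (hM.effect_bound n').trans hn'.le
  have key := sum_sq_bound (norm_nonneg r) hr hp hq hA hB hpos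
  have hform : ∀ g, steeringForm t S r g = (⟪t, g⟫ + ‖r‖ * ⟪S g, e⟫) ^ 2
      + (1 - ‖r‖ ^ 2) * (‖S g‖ ^ 2 - ⟪t, g⟫ ^ 2) := by
    intro g
    have : ⟪S g, r⟫ = ‖r‖ * ⟪S g, e⟫ := by
      conv_lhs => rw [hre]
      rw [real_inner_smul_right]
    rw [steeringForm, this]
  rw [← hform, ← hform] at key
  have ha1 : ‖S m'‖ ≤ 1 := by linarith [abs_nonneg ⟪t, m'⟫]
  have hb1 : ‖S n'‖ ≤ 1 := by linarith [abs_nonneg ⟪t, n'⟫]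
  have ha0 := norm_nonneg (S m')
  have hb0 := norm_nonneg (S n')
  have hr0 := norm_nonneg r
  set a := ‖S m'‖ with ha
  set b := ‖S n'‖ with hb
  have hV1 : 1 < steeringForm t S r m' + steeringForm t S r n' := by
    by_contra h
    exact absurd (Real.sqrt_le_one.mpr (not_lt.mp h)) (not_le.mpr hV)
  have hν : 1 < a + b := by
    by_contra! h
    have h1 : 2 * ‖r‖ * (1 - ‖r‖) * (a + b - 1) ≤ 0 :=
      mul_nonpos_of_nonneg_of_nonpos (by nlinarith) (by linarith)
    have h2 : (1 - ‖r‖) ^ 2 * (a ^ 2 + b ^ 2 - 1) ≤ 0 :=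
      mul_nonpos_of_nonneg_of_nonpos (sq_nonneg _) (by nlinarith)
    linarith
  have ha2 : a ≠ 0 := by linarith
  have hb2 : b ≠ 0 := by linarith
  refine ⟨a⁻¹ • S m', b⁻¹ • S n', m', n', ?_, ?_, ?_, hm', hn', hmn', ?_⟩
  · rw [norm_smul, ← ha, norm_inv, Real.norm_of_nonneg ha0, inv_mul_cancel₀ ha2]
  · rw [norm_smul, ← hb, norm_inv, Real.norm_of_nonneg hb0, inv_mul_cancel₀ hb2]
  · rw [real_inner_smul_left, real_inner_smul_right, hort]; simp
  have i1 : ⟪m', T (a⁻¹ • S m')⟫ = a := by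
    rw [map_smul, real_inner_smul_right, real_inner_comm, hM.adjoint, real_inner_self_eq_norm_sq,
      ← ha]
    field_simp
  have i2 : ⟪n', T (b⁻¹ • S n')⟫ = b := by
    rw [map_smul, real_inner_smul_right, real_inner_comm, hM.adjoint, real_inner_self_eq_norm_sq,
      ← hb]
    field_simp
  rw [i1, i2]
  refine le_trans (Real.sqrt_le_sqrt ?_)
    (sqrt_le_affine (μ := ‖r‖) (δ := a + b - 1) (by linarith) (by linarith))
  -- The two brackets differ by `2(1 - a)(1 - b) ≥ 0`.
  have h3 : (1 - ‖r‖) ^ 2 * (a ^ 2 + b ^ 2 - 1) ≤ (1 - ‖r‖) ^ 2 * (a + b - 1) ^ 2 := by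
    refine mul_le_mul_of_nonneg_left ?_ (sq_nonneg _)
    nlinarith
  linarith

/-- A violation of the CHSH inequality forces the adjoint to have a large nuclear norm on some
plane. -/
theorem exists_orthonormal_of_chsh [Nontrivial E] (hM : IsBallMap t T S)
    (h₀ : Dominated r a₀ w₀) (h₁ : Dominated r a₁ w₁) {γ₀ γ₁ : ℝ} {g₀ g₁ : E}
    (hg₀ : |γ₀| + ‖g₀‖ ≤ 1) (hg₁ : |γ₁| + ‖g₁‖ ≤ 1) {β : ℝ}
    (hβ : β = γ₀ * (a₀ + a₁) + ⟪g₀, (a₀ + a₁) • t + T (w₀ + w₁)⟫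
      + (γ₁ * (a₁ - a₀) + ⟪g₁, (a₁ - a₀) • t + T (w₁ - w₀)⟫)) (hβ2 : 2 < β) :
    ∃ u v m n : E, ‖u‖ = 1 ∧ ‖v‖ = 1 ∧ ⟪u, v⟫ = 0 ∧ ‖m‖ = 1 ∧ ‖n‖ = 1 ∧ ⟪m, n⟫ = 0 ∧
      β / 2 ≤ SK + (√2 - SK) * (⟪m, T u⟫ + ⟪n, T v⟫ - 1) := by
  -- The extreme observables are `±1` and the unit Bloch vectors. In each of the two terms either
  -- `±1` is optimal, and then `β ≤ 2`, or a unit vector is.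
  have hle : ∀ {γ : ℝ} {g : E}, |γ| + ‖g‖ ≤ 1 → ∀ (x : ℝ) (y : E),
      γ * x + ⟪g, y⟫ ≤ max |x| ‖y‖ := by
    intro γ g h x y
    have i1 : γ * x ≤ |γ| * max |x| ‖y‖ := by
      refine (le_abs_self _).trans ?_
      rw [abs_mul]
      exact mul_le_mul_of_nonneg_left (le_max_left _ _) (abs_nonneg _)
    have i2 : ⟪g, y⟫ ≤ ‖g‖ * max |x| ‖y‖ :=
      (real_inner_le_norm _ _).trans
        (mul_le_mul_of_nonneg_left (le_max_right _ _) (norm_nonneg _))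
    have i3 : 0 ≤ max |x| ‖y‖ := (abs_nonneg x).trans (le_max_left _ _)
    nlinarith
  have hpull : ∀ {γ : ℝ} {g : E}, |γ| + ‖g‖ ≤ 1 → |γ + ⟪t, g⟫| + ‖S g‖ ≤ 1 := by
    intro γ g h
    have := hM.effect_bound g
    have := abs_add_le γ ⟪t, g⟫
    linarith
  have hx := hle hg₀ (a₀ + a₁) ((a₀ + a₁) • t + T (w₀ + w₁))
  have hy := hle hg₁ (a₁ - a₀) ((a₁ - a₀) • t + T (w₁ - w₀))
  rcases le_total ‖(a₀ + a₁) • t + T (w₀ + w₁)‖ |a₀ + a₁| with c | c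
  · exfalso
    rw [max_eq_left c] at hx
    have := classical_of_trivial_observable h₀ h₁ (hpull hg₁)
    rw [hM.inner_image g₁] at hβ
    rw [hM.inner_image g₀] at *
    linarith
  rcases le_total ‖(a₁ - a₀) • t + T (w₁ - w₀)‖ |a₁ - a₀| with d | d
  · exfalso
    rw [max_eq_left d] at hy
    -- Replacing `ω₀` by `-ω₀` exchanges the sum and the difference.
    have := classical_of_trivial_observable h₀.neg h₁ (hpull hg₀)
    rw [hM.inner_image g₀] at hβ
    rw [hM.inner_image g₁] at *
    rw [neg_add_eq_sub, sub_neg_eq_add, sub_neg_eq_add, add_comm a₁ a₀, add_comm w₁ w₀] at this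
    linarith
  rw [max_eq_right c] at hx
  rw [max_eq_right d] at hy
  obtain ⟨k₀, hk₀, hk₀'⟩ := exists_unit_inner_eq_norm ((a₀ + a₁) • t + T (w₀ + w₁))
  obtain ⟨k₁, hk₁, hk₁'⟩ := exists_unit_inner_eq_norm ((a₁ - a₀) • t + T (w₁ - w₀))
  rw [← hk₀'] at hx
  rw [← hk₁'] at hy
  obtain ⟨m, n, hm, hn, hmn, hle'⟩ :=
    hM.exists_orthonormal_of_unit h₀ h₁ hk₀ hk₁ (by linarith)
  obtain ⟨u, v, m', n', hu, hv, huv, hm', hn', hmn', h⟩ :=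
    hM.exists_orthonormal_sqrt_le h₀.norm_le_one hm hn hmn (by linarith)
  exact ⟨u, v, m', n', hu, hv, huv, hm', hn', hmn', by linarith⟩

end IsBallMap

end InnerProduct

/-! ### The Bloch representation -/

/-- The space of Bloch vectors. -/
abbrev Bloch := EuclideanSpace ℝ (Fin 3)

/-- The Hermitian matrix `(a + w · σ) / 2`. -/
def herm (a : ℝ) (w : Bloch) : Matrix (Fin 2) (Fin 2) ℂ :=
  !![((a + w 2) / 2 : ℂ), (w 0 - w 1 * Complex.I) / 2;
     (w 0 + w 1 * Complex.I) / 2, (a - w 2) / 2]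

/-- The Bloch vector of the Hermitian part of a matrix. -/
def blochVec : Matrix (Fin 2) (Fin 2) ℂ →ₗ[ℝ] Bloch where
  toFun R := WithLp.toLp 2 ![(R 0 1).re + (R 1 0).re, (R 1 0).im - (R 0 1).im,
    (R 0 0).re - (R 1 1).re]
  map_add' R R' := by
    ext i; fin_cases i <;> simp <;> ring
  map_smul' c R := by
    ext i; fin_cases i <;> simp <;> ring

lemma blochVec_herm (a : ℝ) (w : Bloch) : blochVec (herm a w) = w := by
  ext i; fin_cases i <;> simp [blochVec, herm] <;> ring

lemma trace_herm (a : ℝ) (w : Bloch) : (herm a w).trace = a := by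
  simp [Matrix.trace, herm]; ring

lemma herm_add (a b : ℝ) (v w : Bloch) : herm (a + b) (v + w) = herm a v + herm b w := by
  ext i j; fin_cases i <;> fin_cases j <;> simp [herm] <;> ring

lemma herm_smul (x a : ℝ) (w : Bloch) : herm (x * a) (x • w) = x • herm a w := by
  ext i j; fin_cases i <;> fin_cases j <;> simp [herm] <;> ring

lemma herm_eq_smul_add (a : ℝ) (w : Bloch) : herm a w = a • herm 1 0 + herm 0 w := by
  rw [← herm_smul, ← herm_add]; simp

lemma isHermitian_herm (a : ℝ) (w : Bloch) : (herm a w).IsHermitian := by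
  ext i j; fin_cases i <;> fin_cases j <;> simp [herm, Complex.ext_iff]

lemma herm_of_isHermitian {R : Matrix (Fin 2) (Fin 2) ℂ} (hR : R.IsHermitian) :
    herm R.trace.re (blochVec R) = R := by
  have h00 := hR.apply 0 0
  have h11 := hR.apply 1 1
  have h01 := hR.apply 0 1
  simp only [Complex.ext_iff, Complex.star_def, Complex.conj_re, Complex.conj_im] at h00 h11 h01
  ext i j
  fin_cases i <;> fin_cases j <;>
    simp [herm, blochVec, Complex.ext_iff, Matrix.trace] <;> (try constructor) <;> linarith

lemma norm_sq_bloch (w : Bloch) : ‖w‖ ^ 2 = w 0 ^ 2 + w 1 ^ 2 + w 2 ^ 2 := by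
  rw [EuclideanSpace.norm_sq_eq, Fin.sum_univ_three]; simp

lemma inner_bloch (v w : Bloch) : inner ℝ v w = v 0 * w 0 + v 1 * w 1 + v 2 * w 2 := by
  rw [PiLp.inner_apply, Fin.sum_univ_three]; simp; ring

lemma trace_herm_mul_herm (v w : Bloch) :
    (herm 0 v * herm 0 w).trace = ((inner ℝ v w / 2 : ℝ) : ℂ) := by
  rw [inner_bloch]
  simp [herm, Matrix.trace, Complex.ext_iff]
  constructor <;> ring

lemma herm_one_mul_self {e : Bloch} (he : ‖e‖ = 1) : herm 1 e * herm 1 e = herm 1 e := by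
  have h := norm_sq_bloch e
  rw [he] at h
  ext i j
  fin_cases i <;> fin_cases j <;>
    simp [herm, Matrix.mul_apply, Complex.ext_iff] <;> constructor <;> nlinarith

lemma posSemidef_herm_one {e : Bloch} (he : ‖e‖ = 1) : (herm 1 e).PosSemidef := by
  have := Matrix.posSemidef_conjTranspose_mul_self (herm 1 e)
  rwa [(isHermitian_herm 1 e).eq, herm_one_mul_self he] at this

/-- Four times the determinant is the squared trace minus the squared length of the Bloch vector. -/
lemma norm_blochVec_le {R : Matrix (Fin 2) (Fin 2) ℂ} (hR : R.PosSemidef) :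
    ‖blochVec R‖ ≤ R.trace.re := by
  have htr : 0 ≤ R.trace.re := (Complex.le_def.mp hR.trace_nonneg).1
  have hdet := (Complex.le_def.mp hR.det_nonneg).1
  refine abs_le_of_sq_le_sq' ?_ htr |>.2
  generalize hw : blochVec R = w
  have h := herm_of_isHermitian hR.isHermitian
  rw [hw] at h
  generalize R.trace.re = a at *
  rw [← h, Matrix.det_fin_two] at hdet
  simp [herm] at hdet
  rw [norm_sq_bloch]
  nlinarith

/-- Real combinations of states span the Hermitian matrices, so positivity of a channel already
makes it preserve Hermiticity. -/
lemma isHermitian_decompose (w : Bloch) :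
    ∃ e : Bloch, ‖e‖ = 1 ∧ herm 0 w = ‖w‖ • herm 1 e - ‖w‖ • herm 1 0 := by
  obtain ⟨e, he, h⟩ := exists_unit_inner_eq_norm w
  refine ⟨e, he, ?_⟩
  have hw := eq_norm_smul_of_inner_eq_norm he h
  rw [herm_eq_smul_add 1 e, smul_add, ← herm_smul ‖w‖ 0 e, ← hw]
  simp

/-! ### Channels on the Bloch ball -/

section channel

variable {M : Matrix (Fin 2) (Fin 2) ℂ →ₗ[ℂ] Matrix (Fin 2) (Fin 2) ℂ}

lemma IsChannel.map_posSemidef {m n : Type*} [Fintype m] [Fintype n]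
    {Φ : Matrix m m ℂ →ₗ[ℂ] Matrix n n ℂ} (hΦ : IsChannel Φ) {R : Matrix m m ℂ}
    (hR : R.PosSemidef) : (Φ R).PosSemidef := by
  have h := hΦ.completelyPositive 1 (R.submatrix Prod.snd Prod.snd) (hR.submatrix _)
  exact h.submatrix fun i => ((0 : Fin 1), i)

lemma posSemidef_herm_one_zero : (herm 1 0).PosSemidef := by
  have : herm 1 0 = (1 / 2 : ℂ) • (1 : Matrix (Fin 2) (Fin 2) ℂ) := by
    ext i j; fin_cases i <;> fin_cases j <;> simp [herm]
  rw [this]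
  exact Matrix.PosSemidef.one.smul (by simp)

lemma isHermitian_smul_real {n : Type*} {R : Matrix n n ℂ} (hR : R.IsHermitian) (x : ℝ) :
    (x • R).IsHermitian := by
  ext i j
  have := hR.apply i j
  simp only [Matrix.conjTranspose_apply, Matrix.smul_apply, star_smul, this]
  simp

lemma IsChannel.map_isHermitian (hM : IsChannel M) {R : Matrix (Fin 2) (Fin 2) ℂ}
    (hR : R.IsHermitian) : (M R).IsHermitian := by
  obtain ⟨e, he, h⟩ := isHermitian_decompose (blochVec R)
  rw [← herm_of_isHermitian hR, herm_eq_smul_add, h]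
  simp only [map_add, map_sub, LinearMap.map_smul_of_tower]
  have h1 := (hM.map_posSemidef posSemidef_herm_one_zero).isHermitian
  have h2 := (hM.map_posSemidef (posSemidef_herm_one he)).isHermitian
  exact (isHermitian_smul_real h1 _).add
    ((isHermitian_smul_real h2 _).sub (isHermitian_smul_real h1 _))

/-- The linear part of the action of a map on Bloch vectors. -/
def blochLin (M : Matrix (Fin 2) (Fin 2) ℂ →ₗ[ℂ] Matrix (Fin 2) (Fin 2) ℂ) :
    Bloch →ₗ[ℝ] Bloch where
  toFun w := blochVec (M (herm 0 w))
  map_add' v w := by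
    rw [← map_add, ← map_add, ← herm_add, add_zero]
  map_smul' x w := by
    rw [RingHom.id_apply, ← map_smul, ← LinearMap.map_smul_of_tower, ← herm_smul, mul_zero]

/-- The image of the centre of the Bloch ball. -/
def blochShift (M : Matrix (Fin 2) (Fin 2) ℂ →ₗ[ℂ] Matrix (Fin 2) (Fin 2) ℂ) : Bloch :=
  blochVec (M (herm 1 0))

lemma blochVec_map (M : Matrix (Fin 2) (Fin 2) ℂ →ₗ[ℂ] Matrix (Fin 2) (Fin 2) ℂ)
    {R : Matrix (Fin 2) (Fin 2) ℂ} (hR : R.IsHermitian) :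
    blochVec (M R) = R.trace.re • blochShift M + blochLin M (blochVec R) := by
  conv_lhs => rw [← herm_of_isHermitian hR, herm_eq_smul_add]
  simp only [map_add, LinearMap.map_smul_of_tower, map_smul]
  rfl

lemma IsChannel.isBallMap (hM : IsChannel M) :
    IsBallMap (blochShift M) (blochLin M) (LinearMap.adjoint (blochLin M)) where
  adjoint x y := (LinearMap.adjoint_inner_right _ _ _).symm
  norm_le e he := by
    have h := norm_blochVec_le (hM.map_posSemidef (posSemidef_herm_one he))
    rwa [hM.tracePreserving, blochVec_map M (isHermitian_herm 1 e), trace_herm, blochVec_herm,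
      Complex.ofReal_one, Complex.one_re, one_smul] at h

lemma IsChannel.map_herm_zero (hM : IsChannel M) (w : Bloch) :
    M (herm 0 w) = herm 0 (blochLin M w) := by
  have h := herm_of_isHermitian (hM.map_isHermitian (isHermitian_herm 0 w))
  rw [hM.tracePreserving, trace_herm] at h
  exact h.symm

end channel

/-! ### Choi fidelities -/

section fidelity

variable {M : Matrix (Fin 2) (Fin 2) ℂ →ₗ[ℂ] Matrix (Fin 2) (Fin 2) ℂ}

lemma conjBy_apply (V R : Matrix (Fin 2) (Fin 2) ℂ) : conjBy V R = V * R * Vᴴ := rfl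

lemma conjBy_mul (V W : Matrix (Fin 2) (Fin 2) ℂ) :
    conjBy (V * W) = (conjBy V).comp (conjBy W) := by
  ext1 R
  simp [conjBy_apply, Matrix.conjTranspose_mul, mul_assoc]

lemma IsChannel.comp {l m n : Type*} [Fintype l] [Fintype m] [Fintype n]
    {Φ : Matrix m m ℂ →ₗ[ℂ] Matrix n n ℂ} {Ψ : Matrix l l ℂ →ₗ[ℂ] Matrix m m ℂ}
    (hΦ : IsChannel Φ) (hΨ : IsChannel Ψ) : IsChannel (Φ.comp Ψ) where
  completelyPositive k R hR := hΦ.completelyPositive k _ (hΨ.completelyPositive k R hR)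
  tracePreserving R := (hΦ.tracePreserving _).trans (hΨ.tracePreserving R)

lemma isChannel_conjBy {V : Matrix (Fin 2) (Fin 2) ℂ} (hV : Vᴴ * V = 1) :
    IsChannel (conjBy V) where
  completelyPositive k R hR := by
    have h : ampliation (Fin k) (conjBy V) R
        = ((1 : Matrix (Fin k) (Fin k) ℂ) ⊗ₖ V) * R * ((1 : Matrix (Fin k) (Fin k) ℂ) ⊗ₖ V)ᴴ := by
      ext ⟨p, i⟩ ⟨q, j⟩
      have hs : ∀ x : Fin k, ∀ c : ℂ, (starRingEnd ℂ) (if q = x then c else 0)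
          = if q = x then (starRingEnd ℂ) c else 0 := fun x c => by split_ifs <;> simp
      simp [ampliation, conjBy_apply, Matrix.mul_apply, Fintype.sum_prod_type, Matrix.one_apply,
        hs]
    rw [h]
    exact hR.mul_mul_conjTranspose_same _
  tracePreserving R := by
    rw [conjBy_apply, Matrix.trace_mul_comm, ← mul_assoc, hV, one_mul]

lemma choiFidelity_nonneg (hM : IsChannel M) : 0 ≤ choiFidelity M := by
  have h := (hM.completelyPositive 2 _ (Matrix.posSemidef_vecMulVec_self_star idKet))
  exact (Complex.le_def.mp (h.dotProduct_mulVec_nonneg idKet)).1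

lemma choiFidelity_eq_sum (M : Matrix (Fin 2) (Fin 2) ℂ →ₗ[ℂ] Matrix (Fin 2) (Fin 2) ℂ) :
    choiFidelity M = (∑ i, ∑ j, (M (Matrix.single i j 1) i j).re) / 4 := by
  have hs : ((√2 : ℝ) : ℂ)⁻¹ * ((√2 : ℝ) : ℂ)⁻¹ = 1 / 2 := by
    rw [← mul_inv, ← Complex.ofReal_mul, Real.mul_self_sqrt (by norm_num)]; norm_num
  have hb : ∀ i j : Fin 2, (Matrix.of fun k l =>
      Matrix.vecMulVec idKet (star idKet) (i, k) (j, l)) = (1 / 2 : ℂ) • Matrix.single i j 1 := by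
    intro i j
    ext k l
    by_cases hk : i = k <;> by_cases hl : j = l <;>
      simp [Matrix.vecMulVec_apply, idKet, hk, hl]
    simpa using hs
  have hc : ∀ i j : Fin 2, choiState M (i, i) (j, j)
      = (1 / 2 : ℂ) * M (Matrix.single i j 1) i j := by
    intro i j
    simp only [choiState, ampliation, Matrix.of_apply]
    rw [hb, map_smul]
    rfl
  have h : star idKet ⬝ᵥ (choiState M *ᵥ idKet)
      = ∑ i, ∑ j, (1 / 2 : ℂ) * choiState M (i, i) (j, j) := by
    simp only [dotProduct, Matrix.mulVec, Fintype.sum_prod_type, Fin.sum_univ_two, idKet,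
      Pi.star_apply]
    simp
    linear_combination (choiState M (0, 0) (0, 0) + choiState M (0, 0) (1, 1)
      + choiState M (1, 1) (0, 0) + choiState M (1, 1) (1, 1)) * hs
  rw [choiFidelity, h]
  simp only [hc, Fin.sum_univ_two]
  simp
  ring

/-- As a trace of the superoperator the fidelity is cyclic, so a unitary on the input can be moved
to the output. -/
lemma choiFidelity_eq_trace (M : Matrix (Fin 2) (Fin 2) ℂ →ₗ[ℂ] Matrix (Fin 2) (Fin 2) ℂ) :
    choiFidelity M = (LinearMap.trace ℂ _ M).re / 4 := by
  rw [choiFidelity_eq_sum, LinearMap.trace_eq_matrix_trace ℂ (Matrix.stdBasis ℂ (Fin 2) (Fin 2)),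
    Matrix.trace]
  have hr : ∀ (R : Matrix (Fin 2) (Fin 2) ℂ) (i j : Fin 2),
      (Matrix.stdBasis ℂ (Fin 2) (Fin 2)).repr R (i, j) = R i j := by
    intro R i j
    simp [Matrix.stdBasis]
  simp [LinearMap.toMatrix_apply, Fintype.sum_prod_type, Matrix.stdBasis_eq_single, hr]

lemma choiFidelity_comp_comm
    (M N : Matrix (Fin 2) (Fin 2) ℂ →ₗ[ℂ] Matrix (Fin 2) (Fin 2) ℂ) :
    choiFidelity (M.comp N) = choiFidelity (N.comp M) := by
  rw [choiFidelity_eq_trace, choiFidelity_eq_trace, LinearMap.trace_comp_comm']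

/-- The Pauli matrix `Z`. -/
def pauliZ : Matrix (Fin 2) (Fin 2) ℂ := !![1, 0; 0, -1]

/-- The Pauli matrix `X`. -/
def pauliX : Matrix (Fin 2) (Fin 2) ℂ := !![0, 1; 1, 0]

/-- The correlations of the Choi state in `Z` and `X` bound its fidelity. -/
lemma choiFidelity_ge_correlations (hM : IsChannel M) :
    ((pauliZ * M pauliZ).trace.re + (pauliX * M pauliX).trace.re) / 4 ≤ choiFidelity M := by
  -- This is `Y` up to a phase. The left side of the claim is the fidelity of `M` minus that of `M`
  -- followed by `Y`, and the latter is nonnegative by complete positivity.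
  have hY : (!![0, 1; -1, 0] : Matrix (Fin 2) (Fin 2) ℂ)ᴴ * !![0, 1; -1, 0] = 1 := by
    ext i j; fin_cases i <;> fin_cases j <;> simp [Matrix.mul_apply]
  have h := choiFidelity_nonneg ((isChannel_conjBy hY).comp hM)
  have hZ : pauliZ = Matrix.single 0 0 1 - Matrix.single 1 1 1 := by
    ext i j; fin_cases i <;> fin_cases j <;> simp [pauliZ]
  have hX : pauliX = Matrix.single 0 1 1 + Matrix.single 1 0 1 := by
    ext i j; fin_cases i <;> fin_cases j <;> simp [pauliX]
  rw [choiFidelity_eq_sum] at h ⊢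
  have e1 : (pauliZ * M pauliZ).trace = M (Matrix.single 0 0 1) 0 0 - M (Matrix.single 1 1 1) 0 0
      - (M (Matrix.single 0 0 1) 1 1 - M (Matrix.single 1 1 1) 1 1) := by
    rw [hZ, map_sub, ← hZ, Matrix.trace_fin_two, Matrix.mul_apply, Matrix.mul_apply]
    simp [pauliZ]
    ring
  have e2 : (pauliX * M pauliX).trace = M (Matrix.single 0 1 1) 1 0 + M (Matrix.single 1 0 1) 1 0
      + (M (Matrix.single 0 1 1) 0 1 + M (Matrix.single 1 0 1) 0 1) := by
    rw [hX, map_add, ← hX, Matrix.trace_fin_two, Matrix.mul_apply, Matrix.mul_apply]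
    simp [pauliX]
  rw [e1, e2]
  simp only [LinearMap.comp_apply, conjBy_apply, Matrix.mul_apply, Fin.sum_univ_two] at h ⊢
  simp only [Complex.add_re, Complex.sub_re]
  simp at h
  linarith

/-- Two anticommuting reflections of the qubit are `Z` and `X` in some orthonormal basis. -/
lemma exists_unitary_pauli {P Q : Matrix (Fin 2) (Fin 2) ℂ} (hP : P.IsHermitian)
    (hQ : Q.IsHermitian) (hPP : P * P = 1) (hQQ : Q * Q = 1) (hPQ : P * Q = -(Q * P)) :
    ∃ B : Matrix (Fin 2) (Fin 2) ℂ, Bᴴ * B = 1 ∧ B * Bᴴ = 1 ∧ P * B = B * pauliZ ∧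
      Q * B = B * pauliX := by
  have h1 : P + 1 ≠ 0 := by
    intro h
    have : P = -1 := eq_neg_of_add_eq_zero_left h
    rw [this] at hPQ
    have h2 : Q + Q = 0 := by
      simpa [eq_neg_iff_add_eq_zero] using hPQ.symm
    have h3 : Q = 0 := by
      have : (2 : ℂ) • Q = 0 := by rw [two_smul, h2]
      simpa using this
    rw [h3, zero_mul] at hQQ
    exact zero_ne_one hQQ
  obtain ⟨x, hx⟩ : ∃ x, (P + 1) *ᵥ x ≠ 0 := by
    by_contra! h
    exact h1 (Matrix.ext_of_mulVec_single fun i => by rw [h, Matrix.zero_mulVec])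
  -- `P + 1` maps onto the `+1` eigenspace of `P`; by anticommutation `Q` sends that eigenvector to
  -- a `-1` eigenvector. The normalised pair forms the columns of `B`.
  set y := (P + 1) *ᵥ x with hy
  have hPy : P *ᵥ y = y := by
    rw [hy, Matrix.mulVec_mulVec, mul_add, hPP, mul_one, add_comm]
  set N : ℝ := (star y ⬝ᵥ y).re with hN
  have hNc : star y ⬝ᵥ y = N := by
    have := Complex.le_def.mp (dotProduct_star_self_nonneg y)
    exact Complex.ext rfl this.2.symm
  have hN0 : 0 < N := by
    have h2 := Matrix.dotProduct_star_self_pos_iff.mpr hx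
    rw [hNc] at h2
    exact_mod_cast h2
  set z : Fin 2 → ℂ := ((√N : ℝ) : ℂ)⁻¹ • y with hz
  have hzz : star z ⬝ᵥ z = 1 := by
    rw [hz, star_smul, smul_dotProduct, dotProduct_smul, hNc, smul_smul, smul_eq_mul, star_inv₀,
      Complex.star_def, Complex.conj_ofReal, ← mul_inv, ← Complex.ofReal_mul,
      Real.mul_self_sqrt hN0.le, inv_mul_cancel₀]
    exact_mod_cast hN0.ne'
  have hPz : P *ᵥ z = z := by rw [hz, Matrix.mulVec_smul, hPy]
  clear_value z
  have hPQz : P *ᵥ (Q *ᵥ z) = -(Q *ᵥ z) := by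
    rw [Matrix.mulVec_mulVec, hPQ, Matrix.neg_mulVec, ← Matrix.mulVec_mulVec, hPz]
  have hQQz : Q *ᵥ (Q *ᵥ z) = z := by rw [Matrix.mulVec_mulVec, hQQ, Matrix.one_mulVec]
  have hsa : ∀ {H : Matrix (Fin 2) (Fin 2) ℂ}, H.IsHermitian → ∀ v w : Fin 2 → ℂ,
      star (H *ᵥ v) ⬝ᵥ w = star v ⬝ᵥ (H *ᵥ w) := by
    intro H hH v w
    rw [Matrix.star_mulVec, hH.eq, Matrix.dotProduct_mulVec]
  have hzQ : star z ⬝ᵥ (Q *ᵥ z) = 0 := by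
    have h2 := hsa hP z (Q *ᵥ z)
    rw [hPz, hPQz, dotProduct_neg] at h2
    exact self_eq_neg.mp h2
  have hQz : star (Q *ᵥ z) ⬝ᵥ z = 0 := by rw [hsa hQ, hzQ]
  have hQQ' : star (Q *ᵥ z) ⬝ᵥ (Q *ᵥ z) = 1 := by rw [hsa hQ, hQQz, hzz]
  have hPw : ∀ {H : Matrix (Fin 2) (Fin 2) ℂ} {v w : Fin 2 → ℂ}, H *ᵥ v = w →
      ∀ i, H i 0 * v 0 + H i 1 * v 1 = w i := by
    rintro H v _ rfl i
    simp [Matrix.mulVec, dotProduct]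
  generalize hw : Q *ᵥ z = w at *
  have a1 := hPw hPz
  have a2 := hPw hPQz
  have a3 := hPw hw
  have a4 := hPw hQQz
  simp only [dotProduct, Fin.sum_univ_two, Pi.star_apply, Pi.neg_apply] at hzz hzQ hQz hQQ' a2
  have hBB : (!![z 0, w 0; z 1, w 1] : Matrix (Fin 2) (Fin 2) ℂ)ᴴ * !![z 0, w 0; z 1, w 1] = 1 := by
    ext i j
    fin_cases i <;> fin_cases j <;> simp [Matrix.mul_apply] <;> simpa using by assumption
  refine ⟨!![z 0, w 0; z 1, w 1], hBB, mul_eq_one_comm.mp hBB, ?_, ?_⟩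
  · ext i j
    fin_cases i <;> fin_cases j <;> simp [Matrix.mul_apply, pauliZ, a1, a2]
  · ext i j
    fin_cases i <;> fin_cases j <;> simp [Matrix.mul_apply, pauliX, a3, a4]

lemma exists_unitary_of_orthonormal {u v : Bloch} (hu : ‖u‖ = 1) (hv : ‖v‖ = 1)
    (huv : inner ℝ u v = 0) :
    ∃ B : Matrix (Fin 2) (Fin 2) ℂ, Bᴴ * B = 1 ∧ B * Bᴴ = 1 ∧
      B * pauliZ * Bᴴ = (2 : ℝ) • herm 0 u ∧ B * pauliX * Bᴴ = (2 : ℝ) • herm 0 v := by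
  have hsq : ∀ {u : Bloch}, ‖u‖ = 1 → ((2 : ℝ) • herm 0 u) * ((2 : ℝ) • herm 0 u) = 1 := by
    intro u hu
    have h := norm_sq_bloch u
    rw [hu] at h
    ext i j
    fin_cases i <;> fin_cases j <;>
      simp [herm, Matrix.mul_apply, Complex.ext_iff] <;> constructor <;> nlinarith
  have hanti : ((2 : ℝ) • herm 0 u) * ((2 : ℝ) • herm 0 v)
      = -(((2 : ℝ) • herm 0 v) * ((2 : ℝ) • herm 0 u)) := by
    rw [inner_bloch] at huv
    ext i j
    fin_cases i <;> fin_cases j <;>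
      simp [herm, Matrix.mul_apply, Complex.ext_iff] <;> constructor <;> linarith
  obtain ⟨B, h1, h2, h3, h4⟩ := exists_unitary_pauli
    (isHermitian_smul_real (isHermitian_herm 0 u) 2)
    (isHermitian_smul_real (isHermitian_herm 0 v) 2) (hsq hu) (hsq hv) hanti
  refine ⟨B, h1, h2, ?_, ?_⟩
  · rw [← h3, mul_assoc, h2, mul_one]
  · rw [← h4, mul_assoc, h2, mul_one]

/-- Some unitary correction attains half the nuclear norm of the channel on any plane. -/
lemma exists_unitary_choiFidelity_ge (hM : IsChannel M) {u v m n : Bloch} (hu : ‖u‖ = 1)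
    (hv : ‖v‖ = 1) (huv : inner ℝ u v = 0) (hm : ‖m‖ = 1) (hn : ‖n‖ = 1)
    (hmn : inner ℝ m n = 0) :
    ∃ V : Matrix.unitaryGroup (Fin 2) ℂ,
      (inner ℝ m (blochLin M u) + inner ℝ n (blochLin M v)) / 2
        ≤ choiFidelity ((conjBy (V : Matrix (Fin 2) (Fin 2) ℂ)).comp M) := by
  obtain ⟨B, b1, b2, b3, b4⟩ := exists_unitary_of_orthonormal hu hv huv
  obtain ⟨C, c1, c2, c3, c4⟩ := exists_unitary_of_orthonormal hm hn hmn
  have hV : B * Cᴴ ∈ Matrix.unitaryGroup (Fin 2) ℂ := by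
    rw [Matrix.mem_unitaryGroup_iff, Matrix.star_eq_conjTranspose, Matrix.conjTranspose_mul,
      Matrix.conjTranspose_conjTranspose, mul_assoc, ← mul_assoc Cᴴ, c1, one_mul, b2]
  refine ⟨⟨B * Cᴴ, hV⟩, ?_⟩
  -- `B` turns `Z, X` into `u, v` and `C` turns them into `m, n`; cyclicity splits the correction `B
  -- * Cᴴ` into a change of basis on each side of `M`.
  have h1 : choiFidelity ((conjBy (B * Cᴴ)).comp M)
      = choiFidelity (((conjBy Cᴴ).comp M).comp (conjBy B)) := by
    rw [conjBy_mul, LinearMap.comp_assoc, choiFidelity_comp_comm]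
  have hc : IsChannel (((conjBy Cᴴ).comp M).comp (conjBy B)) :=
    ((isChannel_conjBy (by rwa [Matrix.conjTranspose_conjTranspose])).comp hM).comp
      (isChannel_conjBy b1)
  have h2 := choiFidelity_ge_correlations hc
  have key : ∀ (S : Matrix (Fin 2) (Fin 2) ℂ) (x y : Bloch), B * S * Bᴴ = (2 : ℝ) • herm 0 x →
      C * S * Cᴴ = (2 : ℝ) • herm 0 y →
      (S * ((((conjBy Cᴴ).comp M).comp (conjBy B)) S)).trace.re
        = 2 * inner ℝ y (blochLin M x) := by
    intro S x y hx hy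
    simp only [LinearMap.comp_apply, conjBy_apply, Matrix.conjTranspose_conjTranspose]
    rw [hx, ← mul_assoc, Matrix.trace_mul_comm, ← mul_assoc, ← mul_assoc, hy,
      LinearMap.map_smul_of_tower, hM.map_herm_zero]
    simp only [Matrix.smul_mul, Matrix.mul_smul, Matrix.trace_smul, trace_herm_mul_herm]
    simp
    ring
  rw [key _ _ _ b3 c3, key _ _ _ b4 c4] at h2
  change _ ≤ choiFidelity ((conjBy (B * Cᴴ)).comp M)
  rw [h1]
  linarith

/-- Entries of a unitary have modulus at most one. Boundedness is needed because a real supremum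
defaults to `0` on an unbounded set. -/
lemma bddAbove_choiFidelity (M : Matrix (Fin 2) (Fin 2) ℂ →ₗ[ℂ] Matrix (Fin 2) (Fin 2) ℂ) :
    BddAbove (Set.range fun V : Matrix.unitaryGroup (Fin 2) ℂ =>
      choiFidelity ((conjBy (V : Matrix (Fin 2) (Fin 2) ℂ)).comp M)) := by
  refine ⟨(∑ i, ∑ j, ∑ k, ∑ l, ‖M (Matrix.single i j 1) l k‖) / 4, ?_⟩
  rintro _ ⟨V, rfl⟩
  simp only [choiFidelity_eq_sum]
  refine div_le_div_of_nonneg_right ?_ (by norm_num)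
  refine Finset.sum_le_sum fun i _ => Finset.sum_le_sum fun j _ => ?_
  refine (Complex.re_le_norm _).trans ?_
  rw [LinearMap.comp_apply, conjBy_apply, Matrix.mul_apply]
  refine (norm_sum_le _ _).trans (Finset.sum_le_sum fun k _ => ?_)
  have hV := entry_norm_bound_of_unitary V.2
  rw [norm_mul, Matrix.conjTranspose_apply, norm_star]
  refine (mul_le_of_le_one_right (norm_nonneg _) (hV j k)).trans ?_
  rw [Matrix.mul_apply]
  refine (norm_sum_le _ _).trans (Finset.sum_le_sum fun l _ => ?_)
  rw [norm_mul]
  exact mul_le_of_le_one_left (norm_nonneg _) (hV i l)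

lemma memoryFidelity_ge (hM : IsChannel M) {u v m n : Bloch} (hu : ‖u‖ = 1)
    (hv : ‖v‖ = 1) (huv : inner ℝ u v = 0) (hm : ‖m‖ = 1) (hn : ‖n‖ = 1)
    (hmn : inner ℝ m n = 0) :
    (inner ℝ m (blochLin M u) + inner ℝ n (blochLin M v)) / 2 ≤ memoryFidelity M := by
  obtain ⟨V, hV⟩ := exists_unitary_choiFidelity_ge hM hu hv huv hm hn hmn
  exact hV.trans (le_ciSup (bddAbove_choiFidelity M) V)

end fidelity

/-! ### Functionals on the qubit -/

/-- Riesz representation on Bloch vectors; the norm bound comes from the pure states along `±g`. -/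
lemma exists_effect_of_functional (f : Matrix (Fin 2) (Fin 2) ℂ →ₗ[ℝ] ℝ)
    (hf : ∀ R : Matrix (Fin 2) (Fin 2) ℂ, R.PosSemidef → |f R| ≤ R.trace.re) :
    ∃ (γ : ℝ) (g : Bloch), |γ| + ‖g‖ ≤ 1 ∧
      ∀ R : Matrix (Fin 2) (Fin 2) ℂ, R.IsHermitian →
        f R = γ * R.trace.re + inner ℝ g (blochVec R) := by
  let l : Bloch →ₗ[ℝ] ℝ :=
    { toFun := fun w => f (herm 0 w)
      map_add' := fun v w => by rw [← map_add, ← herm_add, add_zero]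
      map_smul' := fun x w => by rw [RingHom.id_apply, ← map_smul, ← herm_smul, mul_zero] }
  let g : Bloch := (InnerProductSpace.toDual ℝ Bloch).symm (LinearMap.toContinuousLinearMap l)
  have hg : ∀ w, inner ℝ g w = f (herm 0 w) := fun w => by
    simp only [g, InnerProductSpace.toDual_symm_apply]
    rfl
  have hherm : ∀ a w, f (herm a w) = f (herm 1 0) * a + inner ℝ g w := fun a w => by
    rw [herm_eq_smul_add, map_add, map_smul, hg, smul_eq_mul, mul_comm]
  refine ⟨f (herm 1 0), g, ?_, fun R hR => ?_⟩
  · obtain ⟨e, he, heg⟩ := exists_unit_inner_eq_norm g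
    have h1 := hf _ (posSemidef_herm_one he)
    have h2 := hf _ (posSemidef_herm_one (e := -e) (by rwa [norm_neg]))
    rw [hherm, trace_herm, real_inner_comm, heg] at h1
    rw [hherm, trace_herm, inner_neg_right, real_inner_comm, heg] at h2
    have h1 := abs_le.mp h1
    have h2 := abs_le.mp h2
    simp only [mul_one, Complex.ofReal_one, Complex.one_re] at h1 h2
    rcases abs_cases (f (herm 1 0)) with h | h <;> rw [h.1] <;> linarith
  · conv_lhs => rw [← herm_of_isHermitian hR, hherm]

/-! ### Steering by local measurements -/

section steering

variable {κ m n : Type*} [Fintype κ] [Fintype m] [DecidableEq m] [Fintype n]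
  [DecidableEq n]

lemma kronecker_one_mul_apply (E : Matrix κ κ ℂ) (X : Matrix (κ × n) (κ × n) ℂ) (k : κ) (i : n)
    (q : κ × n) :
    ((E ⊗ₖ (1 : Matrix n n ℂ)) * X) (k, i) q = ∑ l, E k l * X (l, i) q := by
  simp [Matrix.mul_apply, Fintype.sum_prod_type, Matrix.one_apply]

lemma mul_kronecker_one_apply (E : Matrix κ κ ℂ) (X : Matrix (κ × n) (κ × n) ℂ) (p : κ × n) (k : κ)
    (i : n) :
    (X * (E ⊗ₖ (1 : Matrix n n ℂ))) p (k, i) = ∑ l, X p (l, i) * E l k := by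
  simp [Matrix.mul_apply, Fintype.sum_prod_type, Matrix.one_apply]

/-- A measurement on the first factor commutes with a channel on the second, so the memory acts on
the steered states alone. -/
lemma traceFirst_effect_mul_ampliation (E : Matrix κ κ ℂ) (Φ : Matrix m m ℂ →ₗ[ℂ] Matrix n n ℂ)
    (R : Matrix (κ × m) (κ × m) ℂ) :
    traceFirst ((E ⊗ₖ (1 : Matrix n n ℂ)) * ampliation κ Φ R)
      = Φ (traceFirst ((E ⊗ₖ (1 : Matrix m m ℂ)) * R)) := by
  have h : traceFirst ((E ⊗ₖ (1 : Matrix m m ℂ)) * R)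
      = ∑ k, ∑ l, E k l • (Matrix.of fun i j => R (l, i) (k, j)) := by
    ext i j
    simp [traceFirst, kronecker_one_mul_apply, Matrix.sum_apply]
  rw [h]
  simp only [map_sum, map_smul]
  ext i j
  simp [traceFirst, kronecker_one_mul_apply, Matrix.sum_apply, ampliation]

lemma traceFirst_effect_mul_comm (E : Matrix κ κ ℂ) (X : Matrix (κ × n) (κ × n) ℂ) :
    traceFirst ((E ⊗ₖ (1 : Matrix n n ℂ)) * X) = traceFirst (X * (E ⊗ₖ (1 : Matrix n n ℂ))) := by
  ext i j
  simp only [traceFirst, kronecker_one_mul_apply, mul_kronecker_one_apply, Matrix.of_apply]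
  rw [Finset.sum_comm]
  exact Finset.sum_congr rfl fun _ _ => Finset.sum_congr rfl fun _ _ => mul_comm _ _

lemma posSemidef_traceFirst {R : Matrix (κ × n) (κ × n) ℂ} (hR : R.PosSemidef) :
    (traceFirst R).PosSemidef := by
  have h : traceFirst R = ∑ k, R.submatrix (fun i => (k, i)) (fun i => (k, i)) := by
    ext i j
    simp [traceFirst, Matrix.sum_apply]
  rw [h]
  exact Matrix.posSemidef_sum _ fun k _ => hR.submatrix _

open scoped MatrixOrder in
lemma exists_eq_conjTranspose_mul_self {R : Matrix n n ℂ} (hR : R.PosSemidef) :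
    ∃ B : Matrix n n ℂ, R = Bᴴ * B := by
  obtain ⟨B, hB⟩ := CStarAlgebra.nonneg_iff_eq_star_mul_self.mp hR.nonneg
  exact ⟨B, hB⟩

lemma posSemidef_traceFirst_effect_mul [DecidableEq κ] {E : Matrix κ κ ℂ} (hE : E.PosSemidef)
    {R : Matrix (κ × n) (κ × n) ℂ} (hR : R.PosSemidef) :
    (traceFirst ((E ⊗ₖ (1 : Matrix n n ℂ)) * R)).PosSemidef := by
  -- The partial trace is cyclic for operators on the traced factor, so half of `Bᴴ * B` moves to
  -- the other side.
  obtain ⟨B, rfl⟩ := exists_eq_conjTranspose_mul_self hE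
  have h : (Bᴴ * B) ⊗ₖ (1 : Matrix n n ℂ)
      = (Bᴴ ⊗ₖ (1 : Matrix n n ℂ)) * (B ⊗ₖ (1 : Matrix n n ℂ)) := by
    rw [← Matrix.mul_kronecker_mul, one_mul]
  have h' : (Bᴴ ⊗ₖ (1 : Matrix n n ℂ)) = (B ⊗ₖ (1 : Matrix n n ℂ))ᴴ := by
    rw [Matrix.conjTranspose_kronecker, Matrix.conjTranspose_one]
  rw [h, mul_assoc, traceFirst_effect_mul_comm, h']
  exact posSemidef_traceFirst (hR.mul_mul_conjTranspose_same _)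

lemma trace_traceFirst (R : Matrix (κ × n) (κ × n) ℂ) : (traceFirst R).trace = R.trace := by
  simp only [Matrix.trace, traceFirst, Matrix.diag_apply, Matrix.of_apply, Fintype.sum_prod_type]
  exact Finset.sum_comm

lemma trace_mul_re_nonneg {A B : Matrix n n ℂ} (hA : A.PosSemidef) (hB : B.PosSemidef) :
    0 ≤ (A * B).trace.re := by
  obtain ⟨C, rfl⟩ := exists_eq_conjTranspose_mul_self hA
  rw [mul_assoc, Matrix.trace_mul_comm]
  exact (Complex.le_def.mp (hB.mul_mul_conjTranspose_same C).trace_nonneg).1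

end steering

/-! ### The statistics of an experiment -/

namespace Experiment

variable {𝒳 ι' ι β ε' : Type*} [Fintype ι'] [DecidableEq ι'] [Fintype ι]
  [DecidableEq ι] [Fintype β] [DecidableEq β] [Fintype ε'] [DecidableEq ε']
  (T : Experiment 𝒳 ι' ι β ε')

/-- The unnormalised state of `E` before storage, given the outcome `a` of the measurement `x`. -/
def steered (x : 𝒳) (a : Fin 2) : Matrix (Fin 2) (Fin 2) ℂ :=
  traceFirst ((T.povm x a ⊗ₖ (1 : Matrix (Fin 2) (Fin 2) ℂ)) * T.state)

/-- The effect on the retrieved qubit of the final outcome `b`, given the preparation `a`. -/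
def response (a b : Fin 2) : Matrix (Fin 2) (Fin 2) ℂ →ₗ[ℝ] ℝ where
  toFun R := ((T.final b ⊗ₖ (1 : Matrix ε' ε' ℂ)) * (T.U * (T.prep a ⊗ₖ R) * T.Uᴴ)).trace.re
  map_add' R R' := by
    simp only [Matrix.kronecker_add, Matrix.mul_add, Matrix.add_mul, Matrix.trace_add,
      Complex.add_re]
  map_smul' x R := by
    simp only [Matrix.kronecker_smul, Matrix.mul_smul, Matrix.smul_mul, Matrix.trace_smul,
      Complex.smul_re, RingHom.id_apply]

lemma prob_eq (M : Matrix (Fin 2) (Fin 2) ℂ →ₗ[ℂ] Matrix (Fin 2) (Fin 2) ℂ) (a b : Fin 2) (x : 𝒳) :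
    T.prob M a b x = T.response a b (M (T.steered x a)) := by
  rw [prob, midState, traceFirst_effect_mul_ampliation]
  rfl

lemma response_nonneg (a b : Fin 2) {R : Matrix (Fin 2) (Fin 2) ℂ} (hR : R.PosSemidef) :
    0 ≤ T.response a b R :=
  trace_mul_re_nonneg ((T.final_isPOVM.posSemidef b).kronecker Matrix.PosSemidef.one)
    (((T.prep_isDensity a).posSemidef.kronecker hR).mul_mul_conjTranspose_same T.U)

lemma response_add (a : Fin 2) (R : Matrix (Fin 2) (Fin 2) ℂ) :
    T.response a 0 R + T.response a 1 R = R.trace.re := by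
  have h : T.final 0 ⊗ₖ (1 : Matrix ε' ε' ℂ) + T.final 1 ⊗ₖ (1 : Matrix ε' ε' ℂ) = 1 := by
    rw [← Matrix.add_kronecker, ← Fin.sum_univ_two, T.final_isPOVM.sum_eq_one,
      Matrix.one_kronecker_one]
  change Complex.re _ + Complex.re _ = _
  rw [← Complex.add_re, ← Matrix.trace_add, ← add_mul, h, one_mul, Matrix.trace_mul_comm,
    ← Matrix.mul_assoc, T.U_isometry, Matrix.one_mul, Matrix.trace_kronecker, (T.prep_isDensity a).trace_one,
    one_mul]

lemma posSemidef_steered (x : 𝒳) (a : Fin 2) : (T.steered x a).PosSemidef :=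
  posSemidef_traceFirst_effect_mul ((T.povm_isPOVM x).posSemidef a) T.state_isDensity.posSemidef

/-- No signalling: the average steered state is the same for every setting. -/
lemma steered_add (x : 𝒳) : T.steered x 0 + T.steered x 1 = traceFirst T.state := by
  have h : T.povm x 0 ⊗ₖ (1 : Matrix (Fin 2) (Fin 2) ℂ)
      + T.povm x 1 ⊗ₖ (1 : Matrix (Fin 2) (Fin 2) ℂ) = 1 := by
    rw [← Matrix.add_kronecker, ← Fin.sum_univ_two, (T.povm_isPOVM x).sum_eq_one,
      Matrix.one_kronecker_one]
  have h2 : ∀ A B : Matrix (ι' × Fin 2) (ι' × Fin 2) ℂ,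
      traceFirst A + traceFirst B = traceFirst (A + B) := fun A B => by
    ext i j
    simp [traceFirst, Finset.sum_add_distrib]
  rw [steered, steered, h2, ← add_mul, h, one_mul]

/-- The binary observable of the final measurement, given the preparation `a`. -/
lemma exists_effect (a : Fin 2) : ∃ (γ : ℝ) (g : Bloch), |γ| + ‖g‖ ≤ 1 ∧
    ∀ R : Matrix (Fin 2) (Fin 2) ℂ, R.IsHermitian →
      T.response a 0 R - T.response a 1 R = γ * R.trace.re + inner ℝ g (blochVec R) := by
  refine exists_effect_of_functional (T.response a 0 - T.response a 1) fun R hR => ?_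
  have h0 := T.response_nonneg a 0 hR
  have h1 := T.response_nonneg a 1 hR
  have h2 := T.response_add a R
  rw [LinearMap.sub_apply, abs_le]
  constructor <;> linarith

/-- The half-difference of two steered observables. -/
def steeredDiff (x y : 𝒳) : Matrix (Fin 2) (Fin 2) ℂ :=
  (1 / 2 : ℝ) • ((T.steered x 0 - T.steered x 1) - (T.steered y 0 - T.steered y 1))

lemma isHermitian_steeredDiff (x y : 𝒳) : (T.steeredDiff x y).IsHermitian := by
  have h := fun x a => (T.posSemidef_steered x a).isHermitian
  exact isHermitian_smul_real (((h x 0).sub (h x 1)).sub ((h y 0).sub (h y 1))) _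

lemma dominated_steeredDiff (x y : 𝒳) :
    Dominated (blochVec (traceFirst T.state)) (T.steeredDiff x y).trace.re
      (blochVec (T.steeredDiff x y)) := by
  have hσ : traceFirst T.state = (1 / 2 : ℝ) • (T.steered x 0 + T.steered x 1)
      + (1 / 2 : ℝ) • (T.steered y 0 + T.steered y 1) := by
    rw [steered_add, steered_add]; module
  -- Averaging the decompositions of `σ` for the two settings makes `σ ± ω` sums of steered, hence
  -- positive, operators.
  have h1 : traceFirst T.state + T.steeredDiff x y = T.steered x 0 + T.steered y 1 := by
    rw [hσ, steeredDiff]; module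
  have h2 : traceFirst T.state - T.steeredDiff x y = T.steered x 1 + T.steered y 0 := by
    rw [hσ, steeredDiff]; module
  have htr : (traceFirst T.state).trace.re = 1 := by
    rw [trace_traceFirst, T.state_isDensity.trace_one, Complex.one_re]
  constructor
  · have h := norm_blochVec_le ((T.posSemidef_steered x 0).add (T.posSemidef_steered y 1))
    rwa [← h1, map_add, Matrix.trace_add, Complex.add_re, htr] at h
  · have h := norm_blochVec_le ((T.posSemidef_steered x 1).add (T.posSemidef_steered y 0))
    rwa [← h2, map_sub, Matrix.trace_sub, Complex.sub_re, htr] at h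

/-- The quantity `Γ` as a CHSH expression for the qubit channel `M`. -/
lemma exists_chsh_eq_Gam [Finite 𝒳] [Nonempty 𝒳]
    {M : Matrix (Fin 2) (Fin 2) ℂ →ₗ[ℂ] Matrix (Fin 2) (Fin 2) ℂ} (hM : IsChannel M) :
    ∃ (r w₀ w₁ g₀ g₁ : Bloch) (a₀ a₁ γ₀ γ₁ : ℝ), Dominated r a₀ w₀ ∧ Dominated r a₁ w₁ ∧
      |γ₀| + ‖g₀‖ ≤ 1 ∧ |γ₁| + ‖g₁‖ ≤ 1 ∧
      2 * (2 - Gam (T.prob M))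
        = γ₀ * (a₀ + a₁) + inner ℝ g₀ ((a₀ + a₁) • blochShift M + blochLin M (w₀ + w₁))
          + (γ₁ * (a₁ - a₀) + inner ℝ g₁ ((a₁ - a₀) • blochShift M + blochLin M (w₁ - w₀))) := by
  obtain ⟨γ₀, g₀, h₀, e₀⟩ := T.exists_effect 0
  obtain ⟨γ₁, g₁, h₁, e₁⟩ := T.exists_effect 1
  -- The infima are attained because `𝒳` is finite. In the sum over `(b₀, b₁)` the contributions of
  -- `σ` to the observables cancel, leaving differences between the optimal settings for opposite
  -- pairs: `11` against `00`, and `10` against `01`.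
  have hx : ∀ b₀ b₁ : Fin 2, ∃ x : 𝒳, ∑ a : Fin 2, T.prob M a (![b₀, b₁] a) x
      = ⨅ x : 𝒳, ∑ a : Fin 2, T.prob M a (![b₀, b₁] a) x :=
    fun b₀ b₁ => exists_eq_ciInf_of_finite
  choose x hx using hx
  refine ⟨blochVec (traceFirst T.state), _, _, g₀, g₁, _, _, γ₀, γ₁,
    T.dominated_steeredDiff (x 1 1) (x 0 0), T.dominated_steeredDiff (x 1 0) (x 0 1), h₀, h₁, ?_⟩
  set ω₀ := T.steeredDiff (x 1 1) (x 0 0) with hω₀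
  set ω₁ := T.steeredDiff (x 1 0) (x 0 1) with hω₁
  have hh₀ : ω₀.IsHermitian := T.isHermitian_steeredDiff _ _
  have hh₁ : ω₁.IsHermitian := T.isHermitian_steeredDiff _ _
  have r₀ := e₀ _ (hM.map_isHermitian (hh₀.add hh₁))
  have r₁ := e₁ _ (hM.map_isHermitian (hh₁.sub hh₀))
  rw [hM.tracePreserving, blochVec_map M (hh₀.add hh₁), Matrix.trace_add, Complex.add_re,
    map_add blochVec] at r₀
  rw [hM.tracePreserving, blochVec_map M (hh₁.sub hh₀), Matrix.trace_sub, Complex.sub_re,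
    map_sub blochVec] at r₁
  have hΓ : Gam (T.prob M) = ∑ b₀ : Fin 2, ∑ b₁ : Fin 2,
      ∑ a : Fin 2, T.prob M a (![b₀, b₁] a) (x b₀ b₁) := by
    simp only [Gam, hx]
  have hresp : ∀ a R, T.response a 1 R = R.trace.re - T.response a 0 R := fun a R => by
    rw [← T.response_add a R]; ring
  have hst : ∀ x, T.steered x 1 = traceFirst T.state - T.steered x 0 := fun x => by
    rw [← T.steered_add x]; abel
  have htr : (traceFirst T.state).trace.re = 1 := by
    rw [trace_traceFirst, T.state_isDensity.trace_one, Complex.one_re]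
  rw [← r₀, ← r₁, hΓ, hω₀, hω₁]
  simp only [steeredDiff, prob_eq, Fin.sum_univ_two, Matrix.cons_val_zero, Matrix.cons_val_one,
    hresp, hst, hM.tracePreserving, map_add, map_sub, map_smul, LinearMap.map_smul_of_tower,
    Matrix.trace_add, Matrix.trace_sub, Matrix.trace_smul, Complex.add_re, Complex.sub_re,
    Complex.smul_re, smul_eq_mul, htr]
  ring

end Experiment

end TPM

end

theorem mainTheorem5 {𝒳 ι' ι β ε' : Type*} [Fintype 𝒳] [Nonempty 𝒳]
    [Fintype ι'] [DecidableEq ι'] [Fintype ι] [DecidableEq ι]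
    [Fintype β] [DecidableEq β] [Fintype ε'] [DecidableEq ε']
    (M : Matrix (Fin 2) (Fin 2) ℂ →ₗ[ℂ] Matrix (Fin 2) (Fin 2) ℂ) (hM : TPM.IsChannel M)
    (T : TPM.Experiment 𝒳 ι' ι β ε')
    (hviol : TPM.Gam (T.prob M) < 1) :
    TPM.memoryFidelity M ≥
      1 / 2 * (1 - (TPM.Gam (T.prob M) - 2 + TPM.SK) / (√2 - TPM.SK)) := by
  obtain ⟨r, w₀, w₁, g₀, g₁, a₀, a₁, γ₀, γ₁, h₀, h₁, hg₀, hg₁, h⟩ := T.exists_chsh_eq_Gam hM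
  obtain ⟨u, v, m, n, hu, hv, huv, hm, hn, hmn, hle⟩ :=
    hM.isBallMap.exists_orthonormal_of_chsh h₀ h₁ hg₀ hg₁ h (by linarith)
  refine ge_iff_le.mpr (le_trans ?_ (TPM.memoryFidelity_ge hM hu hv huv hm hn hmn))
  have hpos : 0 < √2 - TPM.SK := sub_pos.mpr TPM.SK_lt_sqrt_two
  -- Since `β/2 = 2 - Γ`, this is the affine bound `hle` solved for the nuclear norm.
  have hdiv : -((TPM.Gam (T.prob M) - 2 + TPM.SK) / (√2 - TPM.SK))
      ≤ inner ℝ m (TPM.blochLin M u) + inner ℝ n (TPM.blochLin M v) - 1 := by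
    rw [← neg_div, div_le_iff₀ hpos]
    linarith
  linarith
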